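/- Fix $n\ge 1$. Let $\mathscr U$ be the category whose objects are finite sets $S=S_1\sqcup\cdots\sqcup S_n$ (elements of $S_i$ have weight $i$) and whose morphisms are bijections that do not decrease weights. A $\mathscr U$-module is a functor from $\mathscr U$ to finite-dimensional complex vector spaces that is nonzero on only finitely many objects up to isomorphism; with natural transformations as morphisms these form the abelian category $\mathrm{Mod}_{\mathscr U}$. For $\underline a=(a_1,\dots,a_n)\in\mathbf N^n$ write $\underline a$ also for the weighted set $([a_1],\dots,[a_n])$ in which the elements of $[a_i]$ have weight $i$, and put $\mathfrak S_{\underline a}=\mathfrak S_{a_1}\times\cdots\times\mathfrak S_{a_n}$, the automorphism group of $\underline a$. Let $\mathbf P_{\underline a}$ and $\mathbf I_{\underline a}$ be the $\mathscr U$-modules $\mathbf P_{\underline a}(T)=\mathbf C[\mathrm{Hom}_{\mathscr U}(\underline a,T)]$ and $\mathbf I_{\underline a}(T)=\mathbf C[\mathrm{Hom}_{\mathscr U}(T,\underline a)]^*$, on which $\mathfrak S_{\underline a}$ acts through its action on $\underline a$. For an $n$-tuple of partitions $\underline\lambda=(\lambda^1,\dots,\lambda^n)$ with $|\lambda^i|=a_i$,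 let $\mathbf M_{\underline\lambda}=M_{\lambda^1}\boxtimes\cdots\boxtimes M_{\lambda^n}$ be the external tensor product of complex Specht modules, a representation of $\mathfrak S_{\underline a}$, and put $$\mathbf P_{\underline\lambda}=\mathrm{Hom}_{\mathfrak S_{\underline a}}(\mathbf M_{\underline\lambda},\mathbf P_{\underline a}),\qquad \mathbf I_{\underline\lambda}=\mathrm{Hom}_{\mathfrak S_{\underline a}}(\mathbf M_{\underline\lambda},\mathbf I_{\underline a}).$$ Then: 1. The modules $\mathbf I_{\underline\lambda}$, where $\underline\lambda$ runs over all $n$-tuples of partitions, form a complete irredundant set of indecomposable injectives in $\mathrm{Mod}_{\mathscr U}$: each $\mathbf I_{\underline\lambda}$ is injective and indecomposable, every indecomposable injective object is isomorphic to some $\mathbf I_{\underline\lambda}$, and $\mathbf I_{\underline\lambda}\cong\mathbf I_{\underline\mu}$ only if $\underline\lambda=\underline\mu$. In the same sense, the modules $\mathbf P_{\underline\lambda}$ form a complete irredundant set of indecomposable projectives in $\mathrm{Mod}_{\mathscr U}$. 2. Every object of $\mathrm{Mod}_{\mathscr U}$ has finite injective dimension and finite projective dimension. -/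

import Mathlib

open CategoryTheory Limits
open scoped TensorProduct

noncomputable section

/-- A finite set together with a weight function to `{1, …, n}` (modelled by `Fin n`). -/
structure WeightedSet (n : ℕ) where
  carrier : Type
  [finite : Finite carrier]
  weight : carrier → Fin n

namespace WeightedSet

variable {n : ℕ}

attribute [instance] WeightedSet.finite

/-- An upwards morphism of weighted sets: a bijection which does not decrease weights. -/
@[ext]
structure Hom (S T : WeightedSet n) where
  toEquiv : S.carrier ≃ T.carrier
  le_weight : ∀ x, S.weight x ≤ T.weight (toEquiv x)

/-- The category `𝒰` of `[n]`-weighted finite sets and upwards bijections. -/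
instance : Category (WeightedSet n) where
  Hom := Hom
  id S := ⟨Equiv.refl _, fun _ => le_rfl⟩
  comp f g := ⟨f.toEquiv.trans g.toEquiv, fun x => (f.le_weight x).trans (g.le_weight _)⟩

@[ext]
theorem hom_ext {S T : WeightedSet n} {f g : S ⟶ T}
    (h : ∀ x, f.toEquiv x = g.toEquiv x) : f = g :=
  Hom.ext (Equiv.ext h)

instance (S T : WeightedSet n) : Finite (S ⟶ T) :=
  Finite.of_injective (fun f : S ⟶ T => f.toEquiv) (fun _ _ h => Hom.ext h)

/-- The weighted set `([a₁], …, [aₙ])`, in which `[aᵢ]` has weight `i`. -/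
def std (a : Fin n → ℕ) : WeightedSet n where
  carrier := Σ i, Fin (a i)
  weight := Sigma.fst

/-- The action of `𝔖_a = 𝔖_{a₁} × ⋯ × 𝔖_{aₙ}` on `([a₁], …, [aₙ])`. -/
def stdAct (a : Fin n → ℕ) (g : ∀ i, Equiv.Perm (Fin (a i))) : std a ⟶ std a :=
  ⟨Equiv.sigmaCongrRight g, fun _ => le_rfl⟩

theorem stdAct_one (a : Fin n → ℕ) : stdAct a 1 = 𝟙 (std a) := rfl

theorem stdAct_mul (a : Fin n → ℕ) (g h : ∀ i, Equiv.Perm (Fin (a i))) :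
    stdAct a (g * h) = stdAct a h ≫ stdAct a g := rfl

theorem exists_iso_std (T : WeightedSet n) : ∃ b : Fin n → ℕ, Nonempty (T ≅ std b) := by
  have e : ∀ i, {x : T.carrier // T.weight x = i} ≃
      Fin (Nat.card {x : T.carrier // T.weight x = i}) := fun i => Finite.equivFin _
  let E : T.carrier ≃ Σ i, Fin (Nat.card {x : T.carrier // T.weight x = i}) :=
    (Equiv.sigmaFiberEquiv T.weight).symm.trans (Equiv.sigmaCongrRight e)
  refine ⟨fun i => Nat.card {x : T.carrier // T.weight x = i}, ⟨⟨⟨E, fun _ => le_rfl⟩,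
    ⟨E.symm, fun y => ?_⟩, ?_, ?_⟩⟩⟩
  · obtain ⟨x, rfl⟩ := E.surjective y
    exact (congrArg T.weight (E.symm_apply_apply x)).ge
  · ext x; exact E.symm_apply_apply x
  · ext x; exact E.apply_symm_apply x

/-- There are finitely many weighted sets of a given cardinality, up to isomorphism. -/
theorem exists_finite_representatives (N : ℕ) : ∃ s : Set (WeightedSet n), s.Finite ∧
    ∀ T : WeightedSet n, Nat.card T.carrier = N → ∃ S ∈ s, Nonempty (T ≅ S) := by
  refine ⟨std '' (Set.Iic fun _ => N), (Set.finite_Iic _).image _, fun T hT => ?_⟩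
  obtain ⟨b, ⟨e⟩⟩ := exists_iso_std T
  refine ⟨std b, ⟨b, fun i => ?_, rfl⟩, ⟨e⟩⟩
  have h : Nat.card (std b).carrier = N := (Nat.card_congr e.hom.toEquiv).symm.trans hT
  have h' : ∑ j, b j = N := by simpa [std, Nat.card_sigma] using h
  rw [← h']
  exact Finset.single_le_sum (fun _ _ => Nat.zero_le _) (Finset.mem_univ i)

end WeightedSet

/-- A functor from `𝒰` to finite-dimensional complex vector spaces is supported on finitely many
objects up to isomorphism. -/
def HasFiniteSupport (n : ℕ) : ObjectProperty (WeightedSet n ⥤ FGModuleCat.{0} ℂ) := fun M =>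
  ∃ s : Set (WeightedSet n), s.Finite ∧
    ∀ T : WeightedSet n, Nontrivial (M.obj T) → ∃ S ∈ s, Nonempty (T ≅ S)

/-- The category `Mod_𝒰` of `𝒰`-modules: functors `𝒰 ⥤ Vec` of finite support, and natural
transformations. -/
abbrev UMod (n : ℕ) := (HasFiniteSupport n).FullSubcategory

namespace UMod

variable {n : ℕ}

theorem nontrivial_iff_not_isZero (V : FGModuleCat.{0} ℂ) :
    Nontrivial V ↔ ¬ IsZero V := by
  rw [← not_subsingleton_iff_nontrivial, not_iff_not]
  constructor
  · intro h
    rw [IsZero.iff_id_eq_zero]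
    ext x
    exact Subsingleton.elim _ _
  · intro h
    refine ⟨fun x y => ?_⟩
    have h0 : ∀ z : V, z = 0 := fun z =>
      congrArg (fun f : V ⟶ V => f.hom.hom z) ((IsZero.iff_id_eq_zero V).1 h)
    rw [h0 x, h0 y]

theorem hasFiniteSupport_of_isZero {M N : WeightedSet n ⥤ FGModuleCat.{0} ℂ}
    (hM : HasFiniteSupport n M)
    (h : ∀ T, IsZero (M.obj T) → IsZero (N.obj T)) : HasFiniteSupport n N := by
  obtain ⟨s, hs, hsM⟩ := hM
  refine ⟨s, hs, fun T hT => hsM T ?_⟩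
  rw [nontrivial_iff_not_isZero] at hT ⊢
  exact fun h' => hT (h T h')

instance : (HasFiniteSupport n).IsClosedUnderSubobjects where
  prop_of_mono f _ hN :=
    hasFiniteSupport_of_isZero hN fun T hT => IsZero.of_mono (f.app T) hT

instance : (HasFiniteSupport n).IsClosedUnderQuotients where
  prop_of_epi f _ hM :=
    hasFiniteSupport_of_isZero hM fun T hT => IsZero.of_epi (f.app T) hT

instance : (HasFiniteSupport n).ContainsZero where
  exists_zero := by
    obtain ⟨Z, hZ⟩ := HasZeroObject.zero (C := WeightedSet n ⥤ FGModuleCat.{0} ℂ)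
    exact ⟨Z, hZ, ∅, Set.finite_empty, fun T hT =>
      absurd ((Functor.isZero_iff _).1 hZ T) ((nontrivial_iff_not_isZero _).1 hT)⟩

instance : (HasFiniteSupport n).IsClosedUnderExtensions where
  prop_X₂_of_shortExact {S} hS h₁ h₃ := by
    obtain ⟨s₁, hs₁, hs₁'⟩ := h₁
    obtain ⟨s₃, hs₃, hs₃'⟩ := h₃
    refine ⟨s₁ ∪ s₃, hs₁.union hs₃, fun T hT => ?_⟩
    by_contra! hn
    have z₁ : IsZero (S.X₁.obj T) := by
      by_contra h
      obtain ⟨U, hU, e⟩ := hs₁' T ((nontrivial_iff_not_isZero _).2 h)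
      exact hn U (Or.inl hU) |>.false e.some
    have z₃ : IsZero (S.X₃.obj T) := by
      by_contra h
      obtain ⟨U, hU, e⟩ := hs₃' T ((nontrivial_iff_not_isZero _).2 h)
      exact hn U (Or.inr hU) |>.false e.some
    have := hS.mono_f
    have := hS.epi_g
    have hT' := hS.map ((evaluation (WeightedSet n) (FGModuleCat.{0} ℂ)).obj T)
    exact (nontrivial_iff_not_isZero _).1 hT (hT'.exact.isZero_of_both_isZero z₁ z₃)

instance : (HasFiniteSupport n).IsSerreClass where

instance : (HasFiniteSupport n).IsClosedUnderBinaryProducts where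
  limitsOfShape_le := by
    rintro X ⟨p⟩
    have hB := (IsLimit.postcomposeHomEquiv (diagramIsoPair p.diag) _).symm p.isLimit
    exact (HasFiniteSupport n).prop_of_iso
      ((BinaryBiproduct.isLimit _ _).conePointUniqueUpToIso hB)
      ((HasFiniteSupport n).prop_biprod (p.prop_diag_obj _) (p.prop_diag_obj _))

instance : (HasFiniteSupport n).IsClosedUnderFiniteProducts :=
  ObjectProperty.IsClosedUnderFiniteProducts.mk'

end UMod

/-! Specht modules. -/

/-- The group algebra of the symmetric group `𝔖_m`, where `m = |lam|`. -/
abbrev SymAlgebra (lam : YoungDiagram) := MonoidAlgebra ℂ (Equiv.Perm (Fin lam.card))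

/-- A tableau of shape `lam`, i.e. a numbering of its boxes. Any two choices give isomorphic Specht
modules. -/
def tableau (lam : YoungDiagram) : Fin lam.card ≃ lam.cells :=
  lam.cells.equivFin.symm

/-- The row stabilizer of the tableau. -/
def rowStabilizer (lam : YoungDiagram) : Set (Equiv.Perm (Fin lam.card)) :=
  {σ | ∀ x, (tableau lam (σ x)).1.1 = (tableau lam x).1.1}

/-- The column stabilizer of the tableau. -/
def colStabilizer (lam : YoungDiagram) : Set (Equiv.Perm (Fin lam.card)) :=
  {σ | ∀ x, (tableau lam (σ x)).1.2 = (tableau lam x).1.2}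

open Classical in
/-- The row symmetrizer `∑ σ`, over the row stabilizer. -/
def rowSymmetrizer (lam : YoungDiagram) : SymAlgebra lam :=
  ∑ σ with σ ∈ rowStabilizer lam, MonoidAlgebra.of ℂ _ σ

open Classical in
/-- The column antisymmetrizer `∑ sgn(σ) σ`, over the column stabilizer. -/
def colAntisymmetrizer (lam : YoungDiagram) : SymAlgebra lam :=
  ∑ σ with σ ∈ colStabilizer lam, ((Equiv.Perm.sign σ : ℤ) : ℂ) • MonoidAlgebra.of ℂ _ σ

/-- The Specht module of `lam`: the left ideal generated by the polytabloid
`colAntisymmetrizer * rowSymmetrizer`, inside the permutation module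
`ℂ[𝔖_m] * rowSymmetrizer` of tabloids. -/
def Specht (lam : YoungDiagram) : Submodule (SymAlgebra lam) (SymAlgebra lam) :=
  Submodule.span (SymAlgebra lam) {colAntisymmetrizer lam * rowSymmetrizer lam}

instance (lam : YoungDiagram) : Module.Finite ℂ (Specht lam) :=
  Module.Finite.of_injective ((Specht lam).subtype.restrictScalars ℂ) (Specht lam).injective_subtype

/-- The Specht module as a representation of `𝔖_m`, acting by left multiplication. -/
def spechtRep (lam : YoungDiagram) :
    Representation ℂ (Equiv.Perm (Fin lam.card)) (Specht lam) :=
  (Algebra.lsmul ℂ ℂ (Specht lam)).toRingHom.toMonoidHom.comp (MonoidAlgebra.of ℂ _)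

/-- The representation `M_{λ¹} ⊠ ⋯ ⊠ M_{λⁿ}` of `𝔖_{|λ¹|} × ⋯ × 𝔖_{|λⁿ|}`. -/
def spechtBoxRep {n : ℕ} (lam : Fin n → YoungDiagram) :
    Representation ℂ (∀ i, Equiv.Perm (Fin (lam i).card)) (⨂[ℂ] i, Specht (lam i)) :=
  PiTensorProduct.mapMonoidHom.comp
    (MonoidHom.pi fun i => (spechtRep (lam i)).comp (Pi.evalMonoidHom _ i))

namespace UMod

open WeightedSet

variable {n : ℕ}

/-- A `𝒰`-module `M` with `M(T) = 0` whenever `|T| ≠ N` has finite support. -/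
theorem hasFiniteSupport_of_card {M : WeightedSet n ⥤ FGModuleCat.{0} ℂ} (N : ℕ)
    (h : ∀ T, Nontrivial (M.obj T) → Nat.card T.carrier = N) : HasFiniteSupport n M := by
  obtain ⟨s, hs, hs'⟩ := exists_finite_representatives (n := n) N
  exact ⟨s, hs, fun T hT => hs' T (h T hT)⟩

/-- The principal projective `P_a(T) = ℂ[Hom(a, T)]`. -/
def principalProjective (a : Fin n → ℕ) : UMod n where
  obj :=
    { obj T := FGModuleCat.of ℂ ((std a ⟶ T) →₀ ℂ)
      map ψ := FGModuleCat.ofHom (Finsupp.lmapDomain ℂ ℂ fun φ => φ ≫ ψ)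
      map_id T := by
        ext : 1
        change Finsupp.lmapDomain ℂ ℂ (fun φ : std a ⟶ T => φ ≫ 𝟙 T) = LinearMap.id
        simp only [Category.comp_id]
        exact Finsupp.lmapDomain_id ℂ ℂ
      map_comp {T T' T''} ψ χ := by
        ext : 1
        change Finsupp.lmapDomain ℂ ℂ (fun φ : std a ⟶ T => φ ≫ ψ ≫ χ) =
          Finsupp.lmapDomain ℂ ℂ (fun φ : std a ⟶ T' => φ ≫ χ) ∘ₗ
            Finsupp.lmapDomain ℂ ℂ (fun φ : std a ⟶ T => φ ≫ ψ)
        rw [← Finsupp.lmapDomain_comp]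
        rfl }
  property := hasFiniteSupport_of_card (Nat.card (std a).carrier) fun T hT => by
    by_contra h
    have : IsEmpty (std a ⟶ T) := ⟨fun φ => h (Nat.card_congr φ.toEquiv).symm⟩
    exact not_subsingleton ((std a ⟶ T) →₀ ℂ) inferInstance

/-- The principal injective `I_a(T) = ℂ[Hom(T, a)]^*`. -/
def principalInjective (a : Fin n → ℕ) : UMod n where
  obj :=
    { obj T := FGModuleCat.of ℂ (Module.Dual ℂ ((T ⟶ std a) →₀ ℂ))
      map ψ := FGModuleCat.ofHom (Finsupp.lmapDomain ℂ ℂ fun φ => ψ ≫ φ).dualMap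
      map_id T := by
        ext : 1
        change (Finsupp.lmapDomain ℂ ℂ fun φ : T ⟶ std a => 𝟙 T ≫ φ).dualMap = LinearMap.id
        simp only [Category.id_comp]
        exact (congrArg LinearMap.dualMap (Finsupp.lmapDomain_id ℂ ℂ)).trans LinearMap.dualMap_id
      map_comp {T T' T''} ψ χ := by
        ext : 1
        change (Finsupp.lmapDomain ℂ ℂ fun φ : T'' ⟶ std a => (ψ ≫ χ) ≫ φ).dualMap =
          (Finsupp.lmapDomain ℂ ℂ fun φ : T'' ⟶ std a => χ ≫ φ).dualMap ∘ₗ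
            (Finsupp.lmapDomain ℂ ℂ fun φ : T' ⟶ std a => ψ ≫ φ).dualMap
        rw [LinearMap.dualMap_comp_dualMap, ← Finsupp.lmapDomain_comp]
        rfl }
  property := hasFiniteSupport_of_card (Nat.card (std a).carrier) fun T hT => by
    by_contra h
    have : IsEmpty (T ⟶ std a) := ⟨fun φ => h (Nat.card_congr φ.toEquiv)⟩
    exact not_subsingleton (Module.Dual ℂ ((T ⟶ std a) →₀ ℂ)) inferInstance

/-- Equality of morphisms of `𝒰`-modules can be checked on each vector space. -/
theorem hom_ext' {M N : UMod n} {f g : M ⟶ N}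
    (h : ∀ T, (f.hom.app T).hom.hom = (g.hom.app T).hom.hom) : f = g := by
  ext T : 3
  exact FGModuleCat.hom_ext (h T)

/-- The action of `𝔖_a` on `P_a` by `𝒰`-module automorphisms: `g · [φ] = [φ ∘ g⁻¹]`. -/
def principalProjectiveAct (a : Fin n → ℕ) :
    (∀ i, Equiv.Perm (Fin (a i))) →* End (principalProjective a) where
  toFun g := ObjectProperty.homMk
    { app T := FGModuleCat.ofHom (Finsupp.lmapDomain ℂ ℂ fun φ : std a ⟶ T => stdAct a g⁻¹ ≫ φ)
      naturality T T' ψ := by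
        ext : 1
        change Finsupp.lmapDomain ℂ ℂ (fun φ : std a ⟶ T' => stdAct a g⁻¹ ≫ φ) ∘ₗ
            Finsupp.lmapDomain ℂ ℂ (fun φ : std a ⟶ T => φ ≫ ψ) =
          Finsupp.lmapDomain ℂ ℂ (fun φ : std a ⟶ T => φ ≫ ψ) ∘ₗ
            Finsupp.lmapDomain ℂ ℂ (fun φ : std a ⟶ T => stdAct a g⁻¹ ≫ φ)
        rw [← Finsupp.lmapDomain_comp, ← Finsupp.lmapDomain_comp]
        rfl }
  map_one' := hom_ext' fun T => Finsupp.lmapDomain_id ℂ ℂ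
  map_mul' g h := hom_ext' fun T => by
    change Finsupp.lmapDomain ℂ ℂ (fun φ : std a ⟶ T => stdAct a (g * h)⁻¹ ≫ φ) =
      Finsupp.lmapDomain ℂ ℂ (fun φ : std a ⟶ T => stdAct a g⁻¹ ≫ φ) ∘ₗ
        Finsupp.lmapDomain ℂ ℂ (fun φ : std a ⟶ T => stdAct a h⁻¹ ≫ φ)
    rw [← Finsupp.lmapDomain_comp, mul_inv_rev, stdAct_mul]
    rfl

/-- The action of `𝔖_a` on `I_a` by `𝒰`-module automorphisms: `(g · f)[φ] = f[g⁻¹ ∘ φ]`. -/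
def principalInjectiveAct (a : Fin n → ℕ) :
    (∀ i, Equiv.Perm (Fin (a i))) →* End (principalInjective a) where
  toFun g := ObjectProperty.homMk
    { app T := FGModuleCat.ofHom
        (Finsupp.lmapDomain ℂ ℂ fun φ : T ⟶ std a => φ ≫ stdAct a g⁻¹).dualMap
      naturality T T' ψ := by
        ext : 1
        change (Finsupp.lmapDomain ℂ ℂ fun φ : T' ⟶ std a => φ ≫ stdAct a g⁻¹).dualMap ∘ₗ
            (Finsupp.lmapDomain ℂ ℂ fun φ : T' ⟶ std a => ψ ≫ φ).dualMap =
          (Finsupp.lmapDomain ℂ ℂ fun φ : T' ⟶ std a => ψ ≫ φ).dualMap ∘ₗ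
            (Finsupp.lmapDomain ℂ ℂ fun φ : T ⟶ std a => φ ≫ stdAct a g⁻¹).dualMap
        rw [LinearMap.dualMap_comp_dualMap, LinearMap.dualMap_comp_dualMap,
          ← Finsupp.lmapDomain_comp, ← Finsupp.lmapDomain_comp]
        rfl }
  map_one' := hom_ext' fun T =>
    (congrArg LinearMap.dualMap (Finsupp.lmapDomain_id ℂ ℂ)).trans LinearMap.dualMap_id
  map_mul' g h := hom_ext' fun T => by
    change (Finsupp.lmapDomain ℂ ℂ fun φ : T ⟶ std a => φ ≫ stdAct a (g * h)⁻¹).dualMap =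
      (Finsupp.lmapDomain ℂ ℂ fun φ : T ⟶ std a => φ ≫ stdAct a g⁻¹).dualMap ∘ₗ
        (Finsupp.lmapDomain ℂ ℂ fun φ : T ⟶ std a => φ ≫ stdAct a h⁻¹).dualMap
    rw [LinearMap.dualMap_comp_dualMap, ← Finsupp.lmapDomain_comp, mul_inv_rev, stdAct_mul]
    rfl

section IsotypicPiece

variable {G V : Type} [Group G] [AddCommGroup V] [Module ℂ V] (ρ : Representation ℂ G V)
  (M : UMod n) (act : G →* End M)

/-- If `G` acts on the `𝒰`-module `M`, it acts on each vector space `M(T)`. -/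
def valueRep (T : WeightedSet n) : Representation ℂ G (M.obj.obj T) where
  toFun g := ((act g).hom.app T).hom.hom
  map_one' := by rw [map_one]; rfl
  map_mul' g h := by rw [map_mul]; rfl

theorem map_valueRep {T T' : WeightedSet n} (ψ : T ⟶ T') (g : G) :
    (M.obj.map ψ).hom.hom ∘ₗ valueRep M act T g =
      valueRep M act T' g ∘ₗ (M.obj.map ψ).hom.hom :=
  congrArg (fun f => f.hom.hom) ((act g).hom.naturality ψ).symm

/-- For `ψ : T ⟶ T'`, the map `M(T) → M(T')` is `G`-equivariant. -/
def mapIntertwining {T T' : WeightedSet n} (ψ : T ⟶ T') :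
    (valueRep M act T).IntertwiningMap (valueRep M act T') :=
  ⟨(M.obj.map ψ).hom.hom, map_valueRep M act ψ⟩

/-- The `𝒰`-module `T ↦ Hom_G(V, M(T))`, for a `𝒰`-module `M` on which `G` acts. -/
def isotypicPiece [Module.Finite ℂ V] : UMod n where
  obj :=
    { obj T := FGModuleCat.of ℂ (ρ.IntertwiningMap (valueRep M act T))
      map ψ := FGModuleCat.ofHom
        { toFun f := (mapIntertwining M act ψ).comp f
          map_add' _ _ := by ext; simp
          map_smul' _ _ := by ext; simp }
      map_id T := by
        ext f v
        change (M.obj.map (𝟙 T)).hom.hom (f v) = f v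
        rw [M.obj.map_id]
        rfl
      map_comp ψ χ := by
        ext f v
        change (M.obj.map (ψ ≫ χ)).hom.hom (f v) =
          (M.obj.map χ).hom.hom ((M.obj.map ψ).hom.hom (f v))
        rw [M.obj.map_comp]
        rfl }
  property := by
    obtain ⟨s, hs, hs'⟩ := M.property
    refine ⟨s, hs, fun T hT => hs' T ?_⟩
    by_contra h
    rw [not_nontrivial_iff_subsingleton] at h
    exact not_subsingleton (ρ.IntertwiningMap (valueRep M act T))
      ⟨fun f g => by ext v; exact Subsingleton.elim (α := M.obj.obj T) _ _⟩

end IsotypicPiece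

/-- The `𝒰`-module `P_λ = Hom_{𝔖_a}(M_λ, P_a)`, where `a = (|λ¹|, …, |λⁿ|)`. -/
def projectiveOf (lam : Fin n → YoungDiagram) : UMod n :=
  isotypicPiece (V := ⨂[ℂ] i, Specht (lam i)) (spechtBoxRep lam)
    (principalProjective fun i => (lam i).card)
    (principalProjectiveAct _)

/-- The `𝒰`-module `I_λ = Hom_{𝔖_a}(M_λ, I_a)`, where `a = (|λ¹|, …, |λⁿ|)`. -/
def injectiveOf (lam : Fin n → YoungDiagram) : UMod n :=
  isotypicPiece (V := ⨂[ℂ] i, Specht (lam i)) (spechtBoxRep lam)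
    (principalInjective fun i => (lam i).card)
    (principalInjectiveAct _)

end UMod

end

/-! Both halves rest on the same mechanism. By Yoneda, maps from `principalProjective a` to `M` are
elements of M(a), and maps from `M` to `principalInjective a` are functionals on M(a). Since
epimorphisms and monomorphisms are surjective and injective on values, these objects are projective
and injective. Finite support and finite-dimensional values make finitely many of them cover or
cocover any module.

An endomorphism of `std a` cannot raise any weight, because the total weight is fixed. So the
endomorphism algebra of a principal object is the group algebra A of 𝔖_a (`isRegularFamily_proj`,
`isRegularFamily_inj`). A nonzero map between principal objects for different a and b needs an
upwards bijection that raises some weight, hence strictly raises the total weight.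

The Young symmetrizers supply idempotents e_λ with e_λ A e_λ = ℂ e_λ, with e_λ A e_μ = 0 for λ ≠ μ,
and with 1 in the sum of the ideals A e_λ A. The last fact comes from counting: there are at least
as many diagrams as conjugacy classes. All three properties pass to external products. The external
product of Specht modules is generated by such an idempotent, so Hom_G out of it is the direct
summand of the principal object that the idempotent cuts out (`exists_retract`).

Hence the summands form an `IsTriangularFamily`: endomorphisms are zero or invertible, nonzero maps
between different members strictly increase a rank, and finitely many members cover any object. The
rest is formal. Indecomposability and irredundancy are immediate, and completeness follows from a
nonzero map of maximal rank in a cover. For finite dimension, `induction_rank` covers the top rank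
of an object by a minimal sum of members, which leaves a kernel and a cokernel of lower rank.
Injectives are treated as projectives of the opposite category. -/

noncomputable section

/-! ### Fillings of Young diagrams -/

namespace YoungDiagram

open Finset

/-- Elements of `s` outside `range #s` are at least `#s`, and they replace equally many elements
below `#s`. This minimality lets `rowSum` play the part usually played by the dominance order. -/
theorem sum_range_card_lt {s : Finset ℕ} (h : s ≠ range #s) :
    ∑ i ∈ range #s, i < ∑ i ∈ s, i := by
  have hc : #(range #s \ s) = #(s \ range #s) := by
    have h1 := card_sdiff_add_card_inter (range #s) s
    have h2 := card_sdiff_add_card_inter s (range #s)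
    rw [inter_comm] at h2
    simp only [card_range] at h1
    omega
  have hne : (range #s \ s).Nonempty := by
    rw [nonempty_iff_ne_empty, Ne, sdiff_eq_empty_iff_subset]
    exact fun h' => h (eq_of_subset_of_card_le h' (by simp)).symm
  rw [← sum_sdiff_lt_sum_sdiff]
  calc ∑ i ∈ range #s \ s, i < ∑ _i ∈ range #s \ s, #s :=
        sum_lt_sum_of_nonempty hne fun i hi => by simpa using (mem_sdiff.1 hi).1
    _ = ∑ _i ∈ s \ range #s, #s := by simp [hc]
    _ ≤ ∑ i ∈ s \ range #s, i := sum_le_sum fun i hi => by simpa using (mem_sdiff.1 hi).2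

theorem sum_range_card_le (s : Finset ℕ) : ∑ i ∈ range #s, i ≤ ∑ i ∈ s, i := by
  by_cases h : s = range #s
  · rw [← h]
  · exact (sum_range_card_lt h).le

/-- The sum of the row indices of the boxes of a Young diagram. -/
def rowSum (lam : YoungDiagram) : ℕ := ∑ x : lam.cells, x.1.1

variable {lam mu : YoungDiagram}

/-- The boxes of a given column. -/
def colBoxes (lam : YoungDiagram) (j : ℕ) : Finset lam.cells := {x | x.1.2 = j}

theorem image_row_colBoxes (lam : YoungDiagram) (j : ℕ) :
    (lam.colBoxes j).image (fun x => x.1.1) = range #(lam.colBoxes j) := by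
  have h : (lam.colBoxes j).image (fun x => x.1.1) = range (lam.colLen j) := by
    ext i
    simp only [colBoxes, mem_image, mem_filter, mem_univ, true_and, mem_range,
      ← mem_iff_lt_colLen]
    constructor
    · rintro ⟨x, rfl, rfl⟩
      exact x.2
    · exact fun hi => ⟨⟨(i, j), hi⟩, rfl, rfl⟩
  rw [h]
  have hc := congrArg card h
  rw [card_image_of_injOn, card_range] at hc
  · rw [hc]
  · intro x hx y hy hxy
    simp only [colBoxes, coe_filter, mem_univ, true_and, Set.mem_ofPred_eq] at hx hy
    exact Subtype.ext (Prod.ext hxy (hx.trans hy.symm))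


theorem injOn_colBoxes (f : lam.cells → ℕ)
    (hf : ∀ x y : lam.cells, x.1.2 = y.1.2 → f x = f y → x = y)
    (j : ℕ) : Set.InjOn f (lam.colBoxes j) := by
  intro x hx y hy h
  simp only [colBoxes, coe_filter, mem_univ, true_and, Set.mem_ofPred_eq] at hx hy
  exact hf x y (hx.trans hy.symm) h

theorem sum_colBoxes_row_le (f : lam.cells → ℕ)
    (hf : ∀ x y : lam.cells, x.1.2 = y.1.2 → f x = f y → x = y)
    (j : ℕ) :
    ∑ x ∈ lam.colBoxes j, x.1.1 ≤ ∑ x ∈ lam.colBoxes j, f x := by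
  have h0 := injOn_colBoxes (fun x : lam.cells => x.1.1)
    (fun x y h h' => Subtype.ext (Prod.ext h' h)) j
  have h1 := injOn_colBoxes f hf j
  have e0 := sum_image (f := fun i : ℕ => i) h0
  have e1 := sum_image (f := fun i : ℕ => i) h1
  rw [← e0, ← e1, image_row_colBoxes, ← card_image_of_injOn h1]
  exact sum_range_card_le _

theorem image_colBoxes_eq (f : lam.cells → ℕ)
    (hf : ∀ x y : lam.cells, x.1.2 = y.1.2 → f x = f y → x = y)
    (j : ℕ)
    (h : ∑ x ∈ lam.colBoxes j, f x ≤ ∑ x ∈ lam.colBoxes j, x.1.1) :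
    (lam.colBoxes j).image f = range #(lam.colBoxes j) := by
  have h0 := injOn_colBoxes (fun x : lam.cells => x.1.1)
    (fun x y h h' => Subtype.ext (Prod.ext h' h)) j
  have h1 := injOn_colBoxes f hf j
  have e0 := sum_image (f := fun i : ℕ => i) h0
  have e1 := sum_image (f := fun i : ℕ => i) h1
  rw [← e0, ← e1, image_row_colBoxes, ← card_image_of_injOn h1] at h
  by_contra h'
  rw [← card_image_of_injOn h1] at h'
  exact absurd (sum_range_card_lt h') (not_lt.2 h)

theorem sum_eq_sum_colBoxes (lam : YoungDiagram) (g : lam.cells → ℕ) :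
    ∑ x, g x = ∑ j ∈ univ.image (fun x : lam.cells => x.1.2), ∑ x ∈ lam.colBoxes j, g x :=
  (sum_fiberwise_of_maps_to (fun x _ => mem_image_of_mem _ (mem_univ x)) g).symm

theorem mem_of_sum_le_rowSum (f : lam.cells → ℕ)
    (hf : ∀ x y : lam.cells, x.1.2 = y.1.2 → f x = f y → x = y)
    (h : ∑ x, f x ≤ lam.rowSum) (x : lam.cells) :
    (f x, x.1.2) ∈ lam.cells := by
  rw [rowSum, sum_eq_sum_colBoxes, sum_eq_sum_colBoxes] at h
  -- Column by column `f` sums to at least the row indices, so the bound on the total forces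
  -- equality in every column. Then `f` permutes the rows of each column.
  have hj : ∑ y ∈ lam.colBoxes x.1.2, f y ≤ ∑ y ∈ lam.colBoxes x.1.2, y.1.1 := by
    by_contra! hlt
    exact absurd (sum_lt_sum (fun j _ => sum_colBoxes_row_le f hf j)
      ⟨x.1.2, mem_image_of_mem (fun y : lam.cells => y.1.2) (mem_univ x), hlt⟩) (not_lt.2 h)
  have hx : f x ∈ (lam.colBoxes x.1.2).image f :=
    mem_image_of_mem _ (by simp [colBoxes])
  rw [image_colBoxes_eq f hf _ hj, ← image_row_colBoxes, mem_image] at hx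
  obtain ⟨y, hy, hyx⟩ := hx
  simp only [colBoxes, mem_filter, mem_univ, true_and] at hy
  rw [← hyx, ← hy]
  exact y.2

/-- The permutation within columns which moves each box `x` to the row `f x`. -/
def columnSort (f : lam.cells → ℕ)
    (hf : ∀ x y : lam.cells, x.1.2 = y.1.2 → f x = f y → x = y)
    (h : ∑ x, f x ≤ lam.rowSum) : Equiv.Perm lam.cells :=
  Equiv.ofBijective (fun x => ⟨(f x, x.1.2), mem_of_sum_le_rowSum f hf h x⟩)
    (Finite.injective_iff_bijective.1 fun x y hxy => by
      have h' : (f x, x.1.2) = (f y, y.1.2) := congrArg Subtype.val hxy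
      exact hf x y (Prod.ext_iff.1 h').2 (Prod.ext_iff.1 h').1)

theorem columnSort_row (f : lam.cells → ℕ)
    (hf : ∀ x y : lam.cells, x.1.2 = y.1.2 → f x = f y → x = y)
    (h : ∑ x, f x ≤ lam.rowSum) (x : lam.cells) :
    (columnSort f hf h x).1.1 = f x := rfl

theorem columnSort_col (f : lam.cells → ℕ)
    (hf : ∀ x y : lam.cells, x.1.2 = y.1.2 → f x = f y → x = y)
    (h : ∑ x, f x ≤ lam.rowSum) (x : lam.cells) :
    (columnSort f hf h x).1.2 = x.1.2 := rfl


theorem rowLen_eq_card_subtype (lam : YoungDiagram) (i : ℕ) :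
    lam.rowLen i = Fintype.card {x : lam.cells // x.1.1 = i} := by
  rw [rowLen_eq_card, Fintype.card_subtype, ← card_map (Function.Embedding.subtype _)]
  congr 1
  ext c
  simp only [mem_row_iff, mem_map, mem_filter, mem_univ, true_and, Function.Embedding.subtype_apply]
  exact ⟨fun h => ⟨⟨c, h.1⟩, h.2, rfl⟩, by rintro ⟨x, hx, rfl⟩; exact ⟨x.2, hx⟩⟩

theorem ext_rowLen (h : ∀ i, lam.rowLen i = mu.rowLen i) : lam = mu := by
  apply YoungDiagram.ext
  ext ⟨i, j⟩
  simp only [mem_cells, mem_iff_lt_rowLen, h]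

theorem sum_row_comp (φ : lam.cells ≃ mu.cells) : ∑ x, (φ x).1.1 = mu.rowSum :=
  φ.sum_comp fun y => y.1.1

/-- Sorting within columns gives a permutation of the boxes of `lam` that realises the rows of `φ`.
Undoing it before `φ` leaves a row-preserving bijection, so the row lengths agree. -/
theorem eq_of_columnSort (φ : lam.cells ≃ mu.cells)
    (hφ : ∀ x y : lam.cells, x.1.2 = y.1.2 → (φ x).1.1 = (φ y).1.1 → x = y)
    (h : mu.rowSum ≤ lam.rowSum) : lam = mu := by
  refine ext_rowLen fun i => ?_
  rw [rowLen_eq_card_subtype, rowLen_eq_card_subtype]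
  have h' : ∑ x, (φ x).1.1 ≤ lam.rowSum := (sum_row_comp φ).trans_le h
  let q := columnSort _ hφ h'
  exact Fintype.card_congr ((q.symm.trans φ).subtypeEquiv fun x => by
    have := columnSort_row _ hφ h' (q.symm x)
    rw [Equiv.trans_apply, ← this]
    change _ ↔ (q (q.symm x)).1.1 = i
    rw [Equiv.apply_symm_apply])

end YoungDiagram

/-! ### Group algebras of finite groups -/

namespace MonoidAlgebra

section Group

variable {G : Type} [Group G]

theorem mul_comm_of_forall_of {z : MonoidAlgebra ℂ G}
    (h : ∀ g, of ℂ G g * z = z * of ℂ G g) (x : MonoidAlgebra ℂ G) : x * z = z * x := by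
  induction x using MonoidAlgebra.induction_on with
  | of g => exact h g
  | add x y hx hy => rw [add_mul, mul_add, hx, hy]
  | smul r x hx => rw [smul_mul_assoc, mul_smul_comm, hx]

/-- Coefficients of a central element are constant on conjugacy classes. This bounds the dimension
of the centre by the number of classes. -/
theorem eq_of_central {x y : MonoidAlgebra ℂ G} (hx : ∀ u, u * x = x * u)
    (hy : ∀ u, u * y = y * u)
    (h : ∀ c : ConjClasses G, x.coeff c.out = y.coeff c.out) : x = y := by
  have key : ∀ z : MonoidAlgebra ℂ G, (∀ u, u * z = z * u) → ∀ g,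
      z.coeff g = z.coeff (ConjClasses.mk g).out := by
    intro z hz g
    obtain ⟨u, hu⟩ := isConj_iff.1 (ConjClasses.mk_eq_mk_iff_isConj.1
      (Quot.out_eq (ConjClasses.mk g)).symm : IsConj g (ConjClasses.mk g).out)
    have := congrArg (fun w => w.coeff (u * g)) (hz (of ℂ G u))
    simp only [of_apply, coeff_single_mul_apply, coeff_mul_single_apply] at this
    simpa [← hu] using this
  ext g
  rw [key x hx, key y hy, h]

end Group

variable {G : Type} [Group G] [Fintype G]

theorem coeff_mul_eq_sum (x y : MonoidAlgebra ℂ G) (g : G) :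
    (x * y).coeff g = ∑ h, x.coeff h * y.coeff (h⁻¹ * g) := by
  rw [coeff_mul_apply_left, Finsupp.sum_fintype _ _ (fun _ => zero_mul _)]

theorem eq_sum_single (x : MonoidAlgebra ℂ G) : x = ∑ g, x.coeff g • of ℂ G g := by
  conv_lhs => rw [← sum_coeff_single x, Finsupp.sum_fintype _ _ (fun _ => single_zero _)]
  simp [smul_single]

/-- The conjugate linear anti-involution of the group algebra which inverts group elements. -/
def conjInv : MonoidAlgebra ℂ G →+ MonoidAlgebra ℂ G where
  toFun x := ofCoeff (Finsupp.equivFunOnFinite.symm fun g => star (x.coeff g⁻¹))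
  map_zero' := by ext; simp
  map_add' x y := by ext; simp

theorem coeff_conjInv (x : MonoidAlgebra ℂ G) (g : G) :
    (conjInv x).coeff g = star (x.coeff g⁻¹) := rfl

theorem conjInv_conjInv (x : MonoidAlgebra ℂ G) : conjInv (conjInv x) = x := by
  ext g
  simp [coeff_conjInv]

theorem conjInv_mul (x y : MonoidAlgebra ℂ G) :
    conjInv (x * y) = conjInv y * conjInv x := by
  ext g
  simp only [coeff_conjInv, coeff_mul_eq_sum, star_sum, star_mul']
  refine Fintype.sum_equiv (Equiv.mulLeft g) _ _ fun h => ?_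
  simp [mul_comm]

/-- The coefficient of `x * conjInv x` at 1 is the sum of the |x_g|². This positivity takes the
place of semisimplicity throughout. -/
theorem eq_zero_of_mul_conjInv {x : MonoidAlgebra ℂ G} (h : x * conjInv x = 0) : x = 0 := by
  have h1 : ∑ g, ‖x.coeff g‖ ^ 2 = 0 := by
    have := congrArg (fun z : MonoidAlgebra ℂ G => z.coeff 1) h
    simp only [coeff_mul_eq_sum, coeff_conjInv, mul_one, inv_inv, coeff_zero, Finsupp.coe_zero,
      Pi.zero_apply] at this
    rw [← Complex.ofReal_inj]
    push_cast
    rw [← this]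
    exact Finset.sum_congr rfl fun g _ => (Complex.mul_conj' _).symm
  ext g
  have := (Finset.sum_eq_zero_iff_of_nonneg fun g _ => sq_nonneg _).1 h1 g (Finset.mem_univ g)
  simpa using this

/-- The sum of the conjugates of an element. -/
def conjSum (x : MonoidAlgebra ℂ G) : MonoidAlgebra ℂ G := ∑ g, of ℂ G g * x * of ℂ G g⁻¹

theorem of_mul_conjSum (x : MonoidAlgebra ℂ G) (g : G) :
    of ℂ G g * conjSum x = conjSum x * of ℂ G g := by
  simp only [conjSum, Finset.mul_sum, Finset.sum_mul]
  refine Fintype.sum_equiv (Equiv.mulLeft g) _ _ fun h => ?_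
  simp only [Equiv.coe_mulLeft, mul_inv_rev, map_mul, mul_assoc]
  rw [← map_mul (of ℂ G) g⁻¹, inv_mul_cancel, map_one, mul_one]

theorem mul_conjSum (x y : MonoidAlgebra ℂ G) : y * conjSum x = conjSum x * y :=
  mul_comm_of_forall_of (of_mul_conjSum x) y

theorem coeff_one_conjSum (x : MonoidAlgebra ℂ G) :
    (conjSum x).coeff 1 = Fintype.card G * x.coeff 1 := by
  simp [conjSum, of_apply, coeff_mul_single_apply, coeff_single_mul_apply]

/-- Put w = z z*. Then w w* = z z* z z* = z² (z*)² = 0, and positivity applies twice. -/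
theorem eq_zero_of_central_mul_self {z : MonoidAlgebra ℂ G} (hz : ∀ x, x * z = z * x)
    (h : z * z = 0) : z = 0 := by
  refine eq_zero_of_mul_conjInv (eq_zero_of_mul_conjInv ?_)
  rw [conjInv_mul, conjInv_conjInv, mul_assoc, ← mul_assoc _ z, hz, mul_assoc, ← mul_assoc z z, h,
    zero_mul]

/-- A family of at least as many pairwise orthogonal primitive idempotents in distinct blocks as
there are conjugacy classes meets every block. -/
theorem one_mem_span_of_orthogonal (e : ConjClasses G → MonoidAlgebra ℂ G)
    (h0 : ∀ i, (e i).coeff 1 ≠ 0)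
    (h1 : ∀ i x, ∃ k : ℂ, e i * x * e i = k • e i)
    (h3 : ∀ i, e i * e i = e i)
    (h2 : ∀ i j, i ≠ j → ∀ x, e i * x * e j = 0) :
    (1 : MonoidAlgebra ℂ G) ∈ Submodule.span ℂ {z | ∃ i x y, z = x * e i * y} := by
  classical
  have hz0 : ∀ i, conjSum (e i) ≠ 0 := fun i h => by
    have := coeff_one_conjSum (e i)
    rw [h] at this
    simp only [coeff_zero, Finsupp.coe_zero, Pi.zero_apply, zero_eq_mul, Nat.cast_eq_zero,
      Fintype.card_ne_zero, false_or] at this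
    exact h0 i this
  have hs : ∀ i, ∃ k : ℂ, k ≠ 0 ∧ conjSum (e i) * conjSum (e i) = k • conjSum (e i) := by
    intro i
    -- With z = `conjSum (e i)` central, `h1` gives z e_i = k e_i. Summing over conjugates gives z²
    -- = k z, and k ≠ 0 because a nonzero central element does not square to zero.
    obtain ⟨k, hk⟩ := h1 i (conjSum (e i))
    rw [mul_conjSum, mul_assoc, h3] at hk
    have hk' : conjSum (e i) * conjSum (e i) = k • conjSum (e i) := by
      conv_lhs => rhs; rw [conjSum]
      conv_rhs => rw [conjSum]
      rw [Finset.mul_sum, Finset.smul_sum]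
      refine Finset.sum_congr rfl fun g _ => ?_
      rw [← mul_assoc, ← mul_assoc, ← of_mul_conjSum, mul_assoc (of ℂ G g), hk, mul_smul_comm,
        smul_mul_assoc]
    refine ⟨k, ?_, hk'⟩
    rintro rfl
    exact hz0 i (eq_zero_of_central_mul_self (mul_conjSum _) (by rw [hk', zero_smul]))
  have hzz : ∀ i j, i ≠ j → conjSum (e i) * conjSum (e j) = 0 := by
    intro i j hij
    rw [conjSum, Finset.sum_mul]
    refine Finset.sum_eq_zero fun g _ => ?_
    rw [mul_assoc, mul_conjSum, conjSum, Finset.sum_mul, Finset.mul_sum]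
    refine Finset.sum_eq_zero fun h _ => ?_
    simp only [← mul_assoc]
    rw [mul_assoc (of ℂ G g), mul_assoc (of ℂ G g), h2 i j hij, mul_zero, zero_mul, zero_mul]
  choose k hk0 hk using hs
  -- The complement of all the normalised block idempotents; it must be shown to vanish.
  let d : MonoidAlgebra ℂ G := 1 - ∑ i, (k i)⁻¹ • conjSum (e i)
  have hdz : ∀ i, conjSum (e i) * d = 0 := by
    intro i
    simp only [d, mul_sub, mul_one, Finset.mul_sum, mul_smul_comm]
    rw [Finset.sum_eq_single i (fun j _ hj => by rw [hzz i j hj.symm, smul_zero]) (by simp), hk,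
      smul_smul, inv_mul_cancel₀ (hk0 i), one_smul, sub_self]
  have hdc : ∀ u, u * d = d * u := by
    intro u
    simp only [d, mul_sub, sub_mul, mul_one, one_mul, Finset.mul_sum, Finset.sum_mul,
      mul_smul_comm, smul_mul_assoc, mul_conjSum]
  have hdd : d * d = d := by
    conv_lhs => rw [show d * d = (1 - ∑ i, (k i)⁻¹ • conjSum (e i)) * d from rfl]
    simp [sub_mul, Finset.sum_mul, hdz]
  have hd : d = 0 := by
    by_contra hd
    -- If `d` were nonzero, it would join the block elements to give one more orthogonal, hence
    -- independent, central element than there are conjugacy classes.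
    let v : Option (ConjClasses G) → MonoidAlgebra ℂ G := fun o => o.elim d fun i => conjSum (e i)
    have hvc : ∀ o u, u * v o = v o * u := by
      rintro (_ | i) u
      · exact hdc u
      · exact mul_conjSum _ u
    have hv : ∀ o o', o ≠ o' → v o * v o' = 0 := by
      rintro (_ | i) (_ | j) h
      · exact absurd rfl h
      · exact (hdc _).symm.trans (hdz j)
      · exact hdz i
      · exact hzz i j fun h' => h (congrArg some h')
    have hv0 : ∀ o, v o * v o ≠ 0 := by
      rintro (_ | i) h
      · exact hd (hdd.symm.trans h)
      · rcases smul_eq_zero.1 ((hk i).symm.trans h) with h' | h'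
        exacts [hk0 i h', hz0 i h']
    let T : MonoidAlgebra ℂ G →ₗ[ℂ] (ConjClasses G → ℂ) :=
      { toFun x c := x.coeff c.out
        map_add' _ _ := rfl
        map_smul' _ _ := rfl }
    have hli : LinearIndependent ℂ fun o => T (v o) := by
      rw [Fintype.linearIndependent_iff]
      intro c hc o
      have h' : ∑ o, c o • v o = 0 := by
        refine eq_of_central (fun u => ?_) (by simp) fun x => ?_
        · simp only [Finset.mul_sum, Finset.sum_mul, mul_smul_comm, smul_mul_assoc, hvc]
        · simp only [← map_smul, ← map_sum] at hc
          exact congrFun hc x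
      have h'' := congrArg (fun z => z * v o) h'
      simp only [Finset.sum_mul, smul_mul_assoc, zero_mul] at h''
      rw [Finset.sum_eq_single o (fun j _ hj => by rw [hv j o hj, smul_zero]) (by simp)] at h''
      exact (smul_eq_zero.1 h'').resolve_right (hv0 o)
    have := hli.fintype_card_le_finrank
    simp at this
  have h1' : (1 : MonoidAlgebra ℂ G) = ∑ i, (k i)⁻¹ • conjSum (e i) := sub_eq_zero.1 hd
  rw [h1']
  exact Submodule.sum_mem _ fun i _ => Submodule.smul_mem _ _ (Submodule.sum_mem _ fun g _ =>
    Submodule.subset_span ⟨i, _, _, rfl⟩)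

end MonoidAlgebra

/-! ### Young symmetrizers -/

namespace YoungDiagram

open MonoidAlgebra

variable {m : ℕ} {lam mu : YoungDiagram}

/-- The row stabilizer of a tableau. -/
def rowStab (t : Fin m ≃ lam.cells) : Set (Equiv.Perm (Fin m)) :=
  {σ | ∀ x, (t (σ x)).1.1 = (t x).1.1}

/-- The column stabilizer of a tableau. -/
def colStab (t : Fin m ≃ lam.cells) : Set (Equiv.Perm (Fin m)) :=
  {σ | ∀ x, (t (σ x)).1.2 = (t x).1.2}

open Classical in
/-- The row symmetrizer of a tableau. -/
def rowSym (t : Fin m ≃ lam.cells) : MonoidAlgebra ℂ (Equiv.Perm (Fin m)) :=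
  ∑ σ with σ ∈ rowStab t, of ℂ _ σ

open Classical in
/-- The column antisymmetrizer of a tableau. -/
def colSym (t : Fin m ≃ lam.cells) : MonoidAlgebra ℂ (Equiv.Perm (Fin m)) :=
  ∑ σ with σ ∈ colStab t, ((Equiv.Perm.sign σ : ℤ) : ℂ) • of ℂ _ σ

variable (t : Fin m ≃ lam.cells) (s : Fin m ≃ mu.cells)

theorem one_mem_rowStab : 1 ∈ rowStab t := fun _ => rfl

theorem one_mem_colStab : 1 ∈ colStab t := fun _ => rfl

theorem mul_mem_rowStab {σ τ : Equiv.Perm (Fin m)} (hσ : σ ∈ rowStab t) :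
    σ * τ ∈ rowStab t ↔ τ ∈ rowStab t :=
  forall_congr' fun x => by rw [Equiv.Perm.mul_apply, hσ]

theorem mul_mem_colStab {σ τ : Equiv.Perm (Fin m)} (hσ : σ ∈ colStab t) :
    σ * τ ∈ colStab t ↔ τ ∈ colStab t :=
  forall_congr' fun x => by rw [Equiv.Perm.mul_apply, hσ]

theorem inv_mem_rowStab {σ : Equiv.Perm (Fin m)} : σ⁻¹ ∈ rowStab t ↔ σ ∈ rowStab t := by
  have h : ∀ τ, τ ∈ rowStab t → τ⁻¹ ∈ rowStab t := fun τ hτ => by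
    rw [← mul_mem_rowStab t hτ, mul_inv_cancel]
    exact fun x => rfl
  exact ⟨fun hσ => inv_inv σ ▸ h _ hσ, h σ⟩

theorem inv_mem_colStab {σ : Equiv.Perm (Fin m)} : σ⁻¹ ∈ colStab t ↔ σ ∈ colStab t := by
  have h : ∀ τ, τ ∈ colStab t → τ⁻¹ ∈ colStab t := fun τ hτ => by
    rw [← mul_mem_colStab t hτ, mul_inv_cancel]
    exact fun x => rfl
  exact ⟨fun hσ => inv_inv σ ▸ h _ hσ, h σ⟩

theorem eq_one_of_mem_rowStab_of_mem_colStab {σ : Equiv.Perm (Fin m)} (h : σ ∈ rowStab t)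
    (h' : σ ∈ colStab t) : σ = 1 :=
  Equiv.ext fun x => t.injective (Subtype.ext (Prod.ext (h x) (h' x)))

open Classical in
theorem coeff_rowSym (σ : Equiv.Perm (Fin m)) :
    (rowSym t).coeff σ = if σ ∈ rowStab t then 1 else 0 := by
  simp [rowSym, Finsupp.finsetSum_apply, Finsupp.single_apply]

open Classical in
theorem coeff_colSym (σ : Equiv.Perm (Fin m)) :
    (colSym t).coeff σ = if σ ∈ colStab t then ((Equiv.Perm.sign σ : ℤ) : ℂ) else 0 := by
  simp [colSym, Finsupp.finsetSum_apply, Finsupp.single_apply]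

theorem of_mul_rowSym {σ : Equiv.Perm (Fin m)} (h : σ ∈ rowStab t) :
    of ℂ _ σ * rowSym t = rowSym t := by
  ext τ
  rw [of_apply, coeff_single_mul_apply, coeff_rowSym, coeff_rowSym, one_mul,
    mul_mem_rowStab t ((inv_mem_rowStab t).2 h)]

theorem conjInv_rowSym : conjInv (rowSym t) = rowSym t := by
  ext τ
  rw [coeff_conjInv, coeff_rowSym, coeff_rowSym, inv_mem_rowStab]
  split_ifs <;> simp

theorem conjInv_colSym : conjInv (colSym t) = colSym t := by
  ext τ
  rw [coeff_conjInv, coeff_colSym, coeff_colSym, inv_mem_colStab]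
  split_ifs <;> simp

theorem of_mul_colSym {σ : Equiv.Perm (Fin m)} (h : σ ∈ colStab t) :
    of ℂ _ σ * colSym t = ((Equiv.Perm.sign σ : ℤ) : ℂ) • colSym t := by
  ext τ
  rw [of_apply, coeff_single_mul_apply, coeff_smul, Finsupp.smul_apply, coeff_colSym, coeff_colSym,
    one_mul, mul_mem_colStab t ((inv_mem_colStab t).2 h)]
  split_ifs <;> simp

theorem colSym_mul_of {σ : Equiv.Perm (Fin m)} (h : σ ∈ colStab t) :
    colSym t * of ℂ _ σ = ((Equiv.Perm.sign σ : ℤ) : ℂ) • colSym t := by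
  have h' := congrArg conjInv (of_mul_colSym t ((inv_mem_colStab t).2 h))
  have e1 : conjInv (of ℂ _ σ⁻¹) = of ℂ (Equiv.Perm (Fin m)) σ := by
    ext τ
    simp [coeff_conjInv, Finsupp.single_apply]
  have e2 : ∀ (n : ℤ) x, conjInv ((n : ℂ) • x) = (n : ℂ) • conjInv (G := Equiv.Perm (Fin m)) x := by
    intro n x
    ext τ
    simp [coeff_conjInv]
  rw [conjInv_mul, e1, e2, conjInv_colSym, Equiv.Perm.sign_inv] at h'
  exact h'

theorem rowSym_mul_self : ∃ k : ℂ, k ≠ 0 ∧ rowSym t * rowSym t = k • rowSym t := by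
  classical
  refine ⟨(Finset.univ.filter (· ∈ rowStab t)).card, ?_, ?_⟩
  · rw [Nat.cast_ne_zero, Finset.card_ne_zero]
    exact ⟨1, by simpa using one_mem_rowStab t⟩
  · conv_lhs => lhs; rw [rowSym]
    rw [Finset.sum_mul, Finset.sum_congr rfl fun σ hσ => of_mul_rowSym t (by simpa using hσ)]
    simp [Nat.cast_smul_eq_nsmul]

theorem colSym_mul_self : ∃ k : ℂ, k ≠ 0 ∧ colSym t * colSym t = k • colSym t := by
  classical
  refine ⟨(Finset.univ.filter (· ∈ colStab t)).card, ?_, ?_⟩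
  · rw [Nat.cast_ne_zero, Finset.card_ne_zero]
    exact ⟨1, by simpa using one_mem_colStab t⟩
  · conv_lhs => lhs; rw [colSym]
    rw [Finset.sum_mul]
    have : ∀ σ ∈ Finset.univ.filter (· ∈ colStab t),
        ((Equiv.Perm.sign σ : ℤ) : ℂ) • of ℂ _ σ * colSym t
        = colSym t := by
      intro σ hσ
      rw [smul_mul_assoc, of_mul_colSym t (by simpa using hσ), smul_smul, ← Int.cast_mul]
      simp [-Units.val_mul]
    rw [Finset.sum_congr rfl this]
    simp [Nat.cast_smul_eq_nsmul]

theorem apply_swap_eq {α β : Type*} [DecidableEq α] (f : α → β) {x y : α} (h : f x = f y) (z : α) :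
    f (Equiv.swap x y z) = f z := by
  rw [Equiv.swap_apply_def]
  split_ifs with h1 h2
  · rw [h1, h]
  · rw [h2, h]
  · rfl

/-- Two entries in the same column of `t` and the same row of the translate of `s` by `g` force the
product to vanish. -/
theorem colSym_mul_of_mul_rowSym_eq_zero (g : Equiv.Perm (Fin m)) {x y : Fin m} (hxy : x ≠ y)
    (hc : (t x).1.2 = (t y).1.2) (hr : (s (g⁻¹ x)).1.1 = (s (g⁻¹ y)).1.1) :
    colSym t * of ℂ _ g * rowSym s = 0 := by
  have h1 : Equiv.swap x y ∈ colStab t := apply_swap_eq (fun z => (t z).1.2) hc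
  have h2 : Equiv.swap (g⁻¹ x) (g⁻¹ y) ∈ rowStab s := apply_swap_eq (fun z => (s z).1.1) hr
  have h3 : g = Equiv.swap x y * (g * Equiv.swap (g⁻¹ x) (g⁻¹ y)) := by
    rw [← Equiv.swap_mul_eq_mul_swap, ← mul_assoc, Equiv.swap_mul_self, one_mul]
  have h4 : colSym t * of ℂ _ g * rowSym s = -(colSym t * of ℂ _ g * rowSym s) := by
    conv_lhs => rw [h3, map_mul, map_mul, ← mul_assoc, colSym_mul_of t h1, Equiv.Perm.sign_swap hxy,
      mul_assoc, mul_assoc, of_mul_rowSym s h2]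
    simp [mul_assoc]
  have h5 : (2 : ℂ) • (colSym t * of ℂ _ g * rowSym s) = 0 := by
    rw [two_smul]
    nth_rw 1 [h4]
    exact neg_add_cancel _
  exact (smul_eq_zero.1 h5).resolve_left two_ne_zero

theorem transversal_of_ne_zero (g : Equiv.Perm (Fin m))
    (h : colSym t * of ℂ _ g * rowSym s ≠ 0) :
    ∀ x y : lam.cells, x.1.2 = y.1.2 → (s (g⁻¹ (t.symm x))).1.1 = (s (g⁻¹ (t.symm y))).1.1 →
      x = y := by
  intro x y hc hr
  by_contra hxy
  exact h (colSym_mul_of_mul_rowSym_eq_zero t s g (fun h' => hxy (t.symm.injective h'))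
    (by simpa using hc) hr)

/-- Von Neumann's lemma. If the term of `g` survives, sorting within columns writes `g` as a column
permutation times a row permutation. The row symmetrizer absorbs the second, and the column
antisymmetrizer absorbs the first up to sign. -/
theorem colSym_mul_mul_rowSym (x : MonoidAlgebra ℂ (Equiv.Perm (Fin m))) :
    ∃ k : ℂ, colSym t * x * rowSym t = k • (colSym t * rowSym t) := by
  induction x using MonoidAlgebra.induction_on with
  | of g =>
    by_cases h0 : colSym t * of ℂ _ g * rowSym t = 0
    · exact ⟨0, by rw [h0, zero_smul]⟩
    have hφ := transversal_of_ne_zero t t g h0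
    -- The bijection permutes the boxes of one diagram, so the bound that `columnSort` needs holds
    -- with equality.
    have hs := (sum_row_comp (t.symm.trans ((g⁻¹ : Equiv.Perm (Fin m)).trans t))).le
    let q := columnSort _ hφ hs
    let q' : Equiv.Perm (Fin m) := (t.trans q).trans t.symm
    have hq' : q' ∈ colStab t := fun x => by
      refine Eq.trans ?_ (columnSort_col _ hφ hs (t x))
      simp [q', q]
    have hp : q' * g ∈ rowStab t := fun x => by
      refine Eq.trans (b := (q (t (g x))).1.1) (by simp [q']) ?_
      refine (columnSort_row _ hφ hs (t (g x))).trans ?_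
      simp
    have hg : g = q'⁻¹ * (q' * g) := (inv_mul_cancel_left _ _).symm
    refine ⟨((Equiv.Perm.sign q'⁻¹ : ℤ) : ℂ), ?_⟩
    rw [hg, map_mul, ← mul_assoc, colSym_mul_of t ((inv_mem_colStab t).2 hq'), mul_assoc,
      of_mul_rowSym t hp, smul_mul_assoc]
  | add x y hx hy =>
    obtain ⟨k, hk⟩ := hx
    obtain ⟨l, hl⟩ := hy
    exact ⟨k + l, by rw [mul_add, add_mul, hk, hl, add_smul]⟩
  | smul r x hx =>
    obtain ⟨k, hk⟩ := hx
    exact ⟨r * k, by rw [mul_smul_comm, smul_mul_assoc, hk, smul_smul]⟩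

theorem colSym_mul_mul_rowSym_eq_zero (hne : lam ≠ mu) (h : mu.rowSum ≤ lam.rowSum)
    (x : MonoidAlgebra ℂ (Equiv.Perm (Fin m))) : colSym t * x * rowSym s = 0 := by
  induction x using MonoidAlgebra.induction_on with
  | of g =>
    by_contra h0
    exact hne (eq_of_columnSort (t.symm.trans ((g⁻¹ : Equiv.Perm (Fin m)).trans s))
      (transversal_of_ne_zero t s g h0) h)
  | add x y hx hy => rw [mul_add, add_mul, hx, hy, add_zero]
  | smul r x hx => rw [mul_smul_comm, smul_mul_assoc, hx, smul_zero]

/-- The Young symmetrizer of a tableau. -/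
def youngSym : MonoidAlgebra ℂ (Equiv.Perm (Fin m)) := colSym t * rowSym t

theorem youngSym_mul_mul_youngSym (x : MonoidAlgebra ℂ (Equiv.Perm (Fin m))) :
    ∃ k : ℂ, youngSym t * x * youngSym t = k • youngSym t := by
  obtain ⟨k, hk⟩ := colSym_mul_mul_rowSym t (rowSym t * x * colSym t)
  exact ⟨k, by rw [youngSym, ← hk]; simp only [mul_assoc]⟩

/-- `rowSum` is a total comparison, so one of two factorisations vanishes: c_t (⋯) r_s directly, or
the inner factor r_t x c_s, which is `conjInv` of the statement with `t` and `s` exchanged. -/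
theorem youngSym_mul_mul_youngSym_eq_zero (hne : lam ≠ mu)
    (x : MonoidAlgebra ℂ (Equiv.Perm (Fin m))) : youngSym t * x * youngSym s = 0 := by
  have e : youngSym t * x * youngSym s = colSym t * (rowSym t * x * colSym s) * rowSym s := by
    simp only [youngSym, mul_assoc]
  rw [e]
  rcases le_total mu.rowSum lam.rowSum with h | h
  · exact colSym_mul_mul_rowSym_eq_zero t s hne h _
  · have h' := congrArg conjInv (colSym_mul_mul_rowSym_eq_zero s t hne.symm h (conjInv x))
    rw [conjInv_mul, conjInv_mul, conjInv_conjInv, conjInv_rowSym, conjInv_colSym, map_zero,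
      ← mul_assoc] at h'
    rw [h', mul_zero, zero_mul]

theorem coeff_one_youngSym : (youngSym t).coeff 1 = 1 := by
  classical
  rw [youngSym, coeff_mul_eq_sum, Finset.sum_eq_single 1]
  · rw [coeff_colSym, coeff_rowSym, inv_one, one_mul, if_pos (one_mem_colStab t),
      if_pos (one_mem_rowStab t)]
    simp
  · intro σ _ hσ
    rw [coeff_colSym, coeff_rowSym, mul_one, inv_mem_rowStab]
    split_ifs with h1 h2 <;> simp
    exact hσ (eq_one_of_mem_rowStab_of_mem_colStab t h2 h1)
  · simp

/-- Write c and r for the two symmetrizers. If (cr)² = 0, then (crc)(crc)* is a multiple of (cr)²c,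
so crc = 0. Then (cr)(cr)* is a multiple of crc, so cr = 0, against its coefficient 1 at the
identity. -/
theorem youngSym_mul_self : ∃ k : ℂ, k ≠ 0 ∧ youngSym t * youngSym t = k • youngSym t := by
  obtain ⟨k, hk⟩ := youngSym_mul_mul_youngSym t 1
  rw [mul_one] at hk
  refine ⟨k, ?_, hk⟩
  rintro rfl
  obtain ⟨r, hr0, hr⟩ := rowSym_mul_self t
  obtain ⟨c, hc0, hc⟩ := colSym_mul_self t
  rw [zero_smul] at hk
  have h1 : colSym t * rowSym t * colSym t = 0 := by
    refine eq_zero_of_mul_conjInv ?_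
    rw [conjInv_mul, conjInv_mul, conjInv_rowSym, conjInv_colSym]
    calc colSym t * rowSym t * colSym t * (colSym t * (rowSym t * colSym t))
        = colSym t * rowSym t * (colSym t * colSym t) * rowSym t * colSym t := by
          simp only [mul_assoc]
      _ = c • (youngSym t * youngSym t * colSym t) := by
          rw [hc]; simp only [youngSym, mul_assoc, mul_smul_comm, smul_mul_assoc]
      _ = 0 := by rw [hk, zero_mul, smul_zero]
  have h2 : youngSym t = 0 := by
    refine eq_zero_of_mul_conjInv ?_
    rw [youngSym, conjInv_mul, conjInv_rowSym, conjInv_colSym]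
    calc colSym t * rowSym t * (rowSym t * colSym t)
        = colSym t * (rowSym t * rowSym t) * colSym t := by simp only [mul_assoc]
      _ = r • (colSym t * rowSym t * colSym t) := by
          rw [hr]; simp only [mul_smul_comm, smul_mul_assoc]
      _ = 0 := by rw [h1, smul_zero]
  have h3 := coeff_one_youngSym t
  rw [h2] at h3
  simp at h3

/-- The scalar by which a Young symmetrizer is quasi-idempotent. -/
def youngScalar : ℂ := (youngSym_mul_self t).choose

theorem youngScalar_ne_zero : youngScalar t ≠ 0 := (youngSym_mul_self t).choose_spec.1

theorem youngSym_mul_youngSym : youngSym t * youngSym t = youngScalar t • youngSym t :=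
  (youngSym_mul_self t).choose_spec.2

/-- The primitive idempotent proportional to the Young symmetrizer. -/
def youngIdem : MonoidAlgebra ℂ (Equiv.Perm (Fin m)) := (youngScalar t)⁻¹ • youngSym t

theorem youngIdem_mul_self : youngIdem t * youngIdem t = youngIdem t := by
  rw [youngIdem, smul_mul_assoc, mul_smul_comm, youngSym_mul_youngSym,
    inv_smul_smul₀ (youngScalar_ne_zero t)]

theorem youngIdem_mul_mul_youngIdem (x : MonoidAlgebra ℂ (Equiv.Perm (Fin m))) :
    ∃ k : ℂ, youngIdem t * x * youngIdem t = k • youngIdem t := by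
  obtain ⟨k, hk⟩ := youngSym_mul_mul_youngSym t x
  refine ⟨(youngScalar t)⁻¹ * k, ?_⟩
  simp only [youngIdem, smul_mul_assoc, mul_smul_comm, hk, smul_smul]
  ring_nf

theorem youngIdem_mul_mul_youngIdem_eq_zero (hne : lam ≠ mu)
    (x : MonoidAlgebra ℂ (Equiv.Perm (Fin m))) : youngIdem t * x * youngIdem s = 0 := by
  simp only [youngIdem, smul_mul_assoc, mul_smul_comm,
    youngSym_mul_mul_youngSym_eq_zero t s hne, smul_zero]

theorem coeff_one_youngIdem : (youngIdem t).coeff 1 ≠ 0 := by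
  simp [youngIdem, coeff_one_youngSym, youngScalar_ne_zero]

/-! ### Conjugacy classes and Young diagrams -/

theorem card_ofRowLens (w : List ℕ) (hw : w.SortedGE) : (ofRowLens w hw).card = w.sum := by
  have h : ∀ w : List ℕ, (YoungDiagram.cellsOfRowLens w).card = w.sum := by
    intro w
    induction w with
    | nil => rfl
    | cons a w ih =>
      rw [YoungDiagram.cellsOfRowLens, Finset.card_union_of_disjoint, Finset.card_map, ih]
      · simp
      · rw [Finset.disjoint_left]
        rintro ⟨i, j⟩ h1 h2
        simp only [Finset.mem_product, Finset.mem_singleton, Finset.mem_map] at h1 h2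
        obtain ⟨c, -, hc⟩ := h2
        have := congrArg Prod.fst hc
        simp [h1.1] at this
  exact h w

/-- The diagram records the cycle type. Injectivity suffices, since the counting argument only needs
one block for each class. -/
theorem exists_injective_conjClasses (m : ℕ) :
    ∃ f : ConjClasses (Equiv.Perm (Fin m)) → {lam : YoungDiagram // lam.card = m},
      Function.Injective f := by
  have hs : ∀ p : Multiset ℕ, (p.sort (· ≥ ·)).SortedGE := fun p =>
    List.sortedGE_iff_pairwise.2 (p.pairwise_sort _)
  let F : Equiv.Perm (Fin m) → {lam : YoungDiagram // lam.card = m} := fun σ =>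
    ⟨ofRowLens (σ.partition.parts.sort (· ≥ ·)) (hs _), by
      rw [card_ofRowLens, ← Multiset.sum_coe, Multiset.sort_eq, σ.partition.parts_sum,
        Fintype.card_fin]⟩
  refine ⟨fun c => F c.out, fun c d h => ?_⟩
  have h1 := congrArg (fun l => YoungDiagram.rowLens l.1) h
  simp only [F] at h1
  rw [rowLens_ofRowLens_eq_self, rowLens_ofRowLens_eq_self] at h1
  · have h2 := congrArg (fun l : List ℕ => (l : Multiset ℕ)) h1
    simp only [Multiset.sort_eq] at h2
    have h3 := Equiv.Perm.partition_eq_of_isConj.2 (Nat.Partition.ext h2)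
    rw [← Quot.out_eq c, ← Quot.out_eq d]
    exact ConjClasses.mk_eq_mk_iff_isConj.2 h3
  · intro x hx
    exact Nat.Partition.parts_pos _ ((Multiset.mem_sort _).1 hx)
  · intro x hx
    exact Nat.Partition.parts_pos _ ((Multiset.mem_sort _).1 hx)

/-- A numbering of the boxes by `Fin m`. -/
def tableauOfCard (lam : YoungDiagram) (h : lam.card = m) : Fin m ≃ lam.cells :=
  (finCongr h.symm).trans (tableau lam)

theorem one_mem_span_youngIdem (m : ℕ) :
    (1 : MonoidAlgebra ℂ (Equiv.Perm (Fin m))) ∈ Submodule.span ℂ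
      {z | ∃ (lam : YoungDiagram) (h : lam.card = m) (x y : _),
        z = x * youngIdem (tableauOfCard lam h) * y} := by
  obtain ⟨f, hf⟩ := exists_injective_conjClasses m
  refine Submodule.span_mono ?_ (one_mem_span_of_orthogonal
    (fun c => youngIdem (tableauOfCard (f c).1 (f c).2)) (fun c => coeff_one_youngIdem _)
    (fun c => youngIdem_mul_mul_youngIdem _) (fun c => youngIdem_mul_self _)
    (fun c d hcd => youngIdem_mul_mul_youngIdem_eq_zero _ _
      fun h => hcd (hf (Subtype.ext h))))
  rintro z ⟨c, x, y, rfl⟩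
  exact ⟨_, (f c).2, x, y, rfl⟩

end YoungDiagram

/-! ### External products -/

/-- Induction on the set of coordinates not yet known to lie in the generating sets; in each one the
map is linear. -/
theorem MultilinearMap.map_mem_span {ι R N : Type*} [CommSemiring R] [Finite ι] {M : ι → Type*}
    [∀ i, AddCommMonoid (M i)] [∀ i, Module R (M i)] [AddCommMonoid N] [Module R N]
    (f : MultilinearMap R M N) (S : ∀ i, Set (M i)) (x : ∀ i, M i)
    (hx : ∀ i, x i ∈ Submodule.span R (S i)) :
    f x ∈ Submodule.span R {z | ∃ y : ∀ i, M i, (∀ i, y i ∈ S i) ∧ z = f y} := by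
  classical
  cases nonempty_fintype ι
  have key : ∀ (s : Finset ι) (x : ∀ i, M i), (∀ i ∈ s, x i ∈ Submodule.span R (S i)) →
      (∀ i ∉ s, x i ∈ S i) →
      f x ∈ Submodule.span R {z | ∃ y : ∀ i, M i, (∀ i, y i ∈ S i) ∧ z = f y} := by
    intro s
    induction s using Finset.induction_on with
    | empty => exact fun x _ hx => Submodule.subset_span ⟨x, fun i => hx i (by simp), rfl⟩
    | insert j s hj ih =>
      intro x hx hx'
      have hu : ∀ v ∈ Submodule.span R (S j), f (Function.update x j v) ∈
          Submodule.span R {z | ∃ y : ∀ i, M i, (∀ i, y i ∈ S i) ∧ z = f y} := by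
        intro v hv
        induction hv using Submodule.span_induction with
        | mem v hv =>
          refine ih _ (fun i hi => ?_) fun i hi => ?_
          · have hij : i ≠ j := fun h => hj (h ▸ hi)
            rw [Function.update_of_ne hij]
            exact hx i (Finset.mem_insert_of_mem hi)
          · by_cases hij : i = j
            · subst hij
              rwa [Function.update_self]
            · rw [Function.update_of_ne hij]
              exact hx' i (by simp [hij, hi])
        | zero => rw [f.map_update_zero]; exact Submodule.zero_mem _
        | add v w _ _ hv hw => rw [f.map_update_add]; exact Submodule.add_mem _ hv hw
        | smul r v _ hv => rw [f.map_update_smul]; exact Submodule.smul_mem _ _ hv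
      have := hu (x j) (hx j (Finset.mem_insert_self _ _))
      rwa [Function.update_eq_self] at this
  exact key Finset.univ x (fun i _ => hx i) fun i hi => absurd (Finset.mem_univ i) hi

namespace MonoidAlgebra

variable {ι : Type} [Fintype ι] {H : ι → Type}

/-- The external product of elements of group algebras. -/
def boxProd [∀ i, Finite (H i)] :
    MultilinearMap ℂ (fun i => MonoidAlgebra ℂ (H i)) (MonoidAlgebra ℂ (∀ i, H i)) :=
  ((coeffLinearEquiv ℂ).symm.toLinearMap ∘ₗ
    (Finsupp.linearEquivFunOnFinite ℂ ℂ (∀ i, H i)).symm.toLinearMap).compMultilinearMap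
    (MultilinearMap.pi fun g => (MultilinearMap.mkPiAlgebra ℂ ι ℂ).compLinearMap fun i =>
      Finsupp.lapply (g i) ∘ₗ (coeffLinearEquiv ℂ).toLinearMap)

theorem coeff_boxProd [∀ i, Finite (H i)] (x : ∀ i, MonoidAlgebra ℂ (H i)) (g : ∀ i, H i) :
    (boxProd x).coeff g = ∏ i, (x i).coeff (g i) := rfl

variable [∀ i, Group (H i)]

theorem boxProd_mul [DecidableEq ι] [∀ i, Fintype (H i)] (x y : ∀ i, MonoidAlgebra ℂ (H i)) :
    boxProd x * boxProd y = boxProd (x * y) := by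
  ext g
  rw [coeff_mul_eq_sum, coeff_boxProd]
  simp only [coeff_boxProd, Pi.mul_apply, coeff_mul_eq_sum, Finset.prod_univ_sum,
    Fintype.piFinset_univ, Finset.prod_mul_distrib, Pi.inv_apply]

theorem boxProd_of [∀ i, Finite (H i)] (g : ∀ i, H i) :
    boxProd (fun i => of ℂ (H i) (g i)) = of ℂ _ g := by
  classical
  ext h
  simp only [coeff_boxProd, of_apply, coeff_single, Finsupp.single_apply, Finset.prod_ite_zero,
    Finset.mem_univ, forall_const, Finset.prod_const_one, funext_iff]

theorem boxProd_one [∀ i, Finite (H i)] :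
    boxProd (1 : ∀ i, MonoidAlgebra ℂ (H i)) = 1 := by
  rw [← map_one (of ℂ (∀ i, H i)), ← boxProd_of]
  simp only [Pi.one_apply, map_one]
  rfl

end MonoidAlgebra

namespace YoungDiagram

open MonoidAlgebra

variable {ι : Type} [Fintype ι] {a : ι → ℕ} {lam mu : ι → YoungDiagram}
  (t : ∀ i, Fin (a i) ≃ (lam i).cells) (s : ∀ i, Fin (a i) ≃ (mu i).cells)

/-- The external product of the primitive idempotents attached to a family of tableaux. -/
def boxIdem : MonoidAlgebra ℂ (∀ i, Equiv.Perm (Fin (a i))) := boxProd fun i => youngIdem (t i)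

theorem boxIdem_ne_zero : boxIdem t ≠ 0 := by
  intro h
  have h' : (boxIdem t).coeff 1 = 0 := by rw [h]; rfl
  rw [boxIdem, coeff_boxProd, Finset.prod_eq_zero_iff] at h'
  obtain ⟨i, -, hi⟩ := h'
  exact coeff_one_youngIdem (t i) hi

variable [DecidableEq ι]

/-- By linearity `x` may be a group element, which is itself an external product, so the one-factor
statement applies in each coordinate. -/
theorem boxIdem_mul_mul_boxIdem (x : MonoidAlgebra ℂ (∀ i, Equiv.Perm (Fin (a i)))) :
    ∃ k : ℂ, boxIdem t * x * boxIdem t = k • boxIdem t := by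
  induction x using MonoidAlgebra.induction_on with
  | of g =>
    choose k hk using fun i => youngIdem_mul_mul_youngIdem (t i) (of ℂ _ (g i))
    refine ⟨∏ i, k i, ?_⟩
    rw [← boxProd_of, boxIdem, boxProd_mul, boxProd_mul, ← MultilinearMap.map_smul_univ]
    exact congrArg _ (funext hk)
  | add x y hx hy =>
    obtain ⟨k, hk⟩ := hx
    obtain ⟨l, hl⟩ := hy
    exact ⟨k + l, by rw [mul_add, add_mul, hk, hl, add_smul]⟩
  | smul r x hx =>
    obtain ⟨k, hk⟩ := hx
    exact ⟨r * k, by rw [mul_smul_comm, smul_mul_assoc, hk, smul_smul]⟩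

theorem boxIdem_mul_mul_boxIdem_eq_zero (hne : lam ≠ mu)
    (x : MonoidAlgebra ℂ (∀ i, Equiv.Perm (Fin (a i)))) : boxIdem t * x * boxIdem s = 0 := by
  induction x using MonoidAlgebra.induction_on with
  | of g =>
    obtain ⟨i, hi⟩ := Function.ne_iff.1 hne
    rw [← boxProd_of, boxIdem, boxIdem, boxProd_mul, boxProd_mul]
    exact boxProd.map_coord_zero i (youngIdem_mul_mul_youngIdem_eq_zero (t i) (s i) hi _)
  | add x y hx hy => rw [mul_add, add_mul, hx, hy, add_zero]
  | smul r x hx => rw [mul_smul_comm, smul_mul_assoc, hx, smul_zero]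

theorem one_mem_span_boxIdem (a : ι → ℕ) :
    (1 : MonoidAlgebra ℂ (∀ i, Equiv.Perm (Fin (a i)))) ∈ Submodule.span ℂ
      {z | ∃ (lam : ι → YoungDiagram) (h : ∀ i, (lam i).card = a i) (x y : _),
        z = x * boxIdem (fun i => tableauOfCard (lam i) (h i)) * y} := by
  rw [← boxProd_one]
  refine Submodule.span_mono ?_ (boxProd.map_mem_span _ _ fun i => one_mem_span_youngIdem (a i))
  rintro z ⟨w, hw, rfl⟩
  choose lam h x y hxy using hw
  refine ⟨lam, h, boxProd x, boxProd y, ?_⟩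
  rw [boxIdem, boxProd_mul, boxProd_mul]
  exact congrArg _ (funext hxy)

end YoungDiagram

/-! ### Specht modules as left ideals generated by idempotents -/

namespace YoungDiagram

open MonoidAlgebra

theorem youngIdem_mem_specht (lam : YoungDiagram) : youngIdem (tableau lam) ∈ Specht lam :=
  (Specht lam).smul_of_tower_mem (youngScalar (tableau lam))⁻¹
    (Submodule.mem_span_singleton_self (youngSym (tableau lam)))

/-- The Specht module is the left ideal A e, on which right multiplication by the idempotent e is
the identity. -/
theorem mul_youngIdem_of_mem_specht {lam : YoungDiagram} {x : SymAlgebra lam}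
    (hx : x ∈ Specht lam) : x * youngIdem (tableau lam) = x := by
  obtain ⟨y, hy⟩ := Submodule.mem_span_singleton.1 hx
  have hy' : y * youngSym (tableau lam) = x := hy
  rw [← hy', youngIdem, mul_smul_comm, mul_assoc, youngSym_mul_youngSym, mul_smul_comm,
    inv_smul_smul₀ (youngScalar_ne_zero _)]

variable {n : ℕ} (lam : Fin n → YoungDiagram)

/-- The generator of the Specht module. -/
def spechtGen (lam : YoungDiagram) : Specht lam := ⟨_, youngIdem_mem_specht lam⟩

theorem sum_coeff_smul_spechtRep {lam : YoungDiagram} (x : Specht lam) :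
    ∑ g, (x : SymAlgebra lam).coeff g • spechtRep lam g (spechtGen lam) = x := by
  apply Subtype.ext
  rw [AddSubmonoidClass.coe_finsetSum]
  conv_rhs => rw [← mul_youngIdem_of_mem_specht x.2, eq_sum_single (x : SymAlgebra lam),
    Finset.sum_mul]
  exact Finset.sum_congr rfl fun g _ => (smul_mul_assoc _ _ _).symm

/-- The embedding of the external product of Specht modules into the group algebra. -/
def spechtBoxEmb : (⨂[ℂ] i, Specht (lam i)) →ₗ[ℂ]
    MonoidAlgebra ℂ (∀ i, Equiv.Perm (Fin (lam i).card)) :=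
  PiTensorProduct.lift (boxProd.compLinearMap fun i => (Specht (lam i)).subtype.restrictScalars ℂ)

theorem spechtBoxEmb_tprod (x : ∀ i, Specht (lam i)) :
    spechtBoxEmb lam (PiTensorProduct.tprod ℂ x) = boxProd fun i => (x i : SymAlgebra (lam i)) :=
  PiTensorProduct.lift.tprod x

theorem spechtBoxRep_tprod (g : ∀ i, Equiv.Perm (Fin (lam i).card)) (x : ∀ i, Specht (lam i)) :
    spechtBoxRep lam g (PiTensorProduct.tprod ℂ x) =
      PiTensorProduct.tprod ℂ fun i => spechtRep (lam i) (g i) (x i) :=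
  PiTensorProduct.map_tprod _ _

theorem spechtBoxEmb_rep (g : ∀ i, Equiv.Perm (Fin (lam i).card)) (v : ⨂[ℂ] i, Specht (lam i)) :
    spechtBoxEmb lam (spechtBoxRep lam g v) = of ℂ _ g * spechtBoxEmb lam v := by
  classical
  induction v using PiTensorProduct.induction_on with
  | smul_tprod r x =>
    rw [map_smul, map_smul, map_smul, mul_smul_comm, spechtBoxRep_tprod, spechtBoxEmb_tprod,
      spechtBoxEmb_tprod, ← boxProd_of, boxProd_mul]
    rfl
  | add v w hv hw =>
    rw [(spechtBoxRep lam g).map_add, (spechtBoxEmb lam).map_add, (spechtBoxEmb lam).map_add,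
      mul_add, hv, hw]

/-- The generator of the external product of Specht modules. -/
def spechtBoxGen : ⨂[ℂ] i, Specht (lam i) := PiTensorProduct.tprod ℂ fun i => spechtGen (lam i)

theorem spechtBoxEmb_gen :
    spechtBoxEmb lam (spechtBoxGen lam) = boxIdem fun i => tableau (lam i) :=
  spechtBoxEmb_tprod lam _

/-- This is x e = x for external products: the image of `v` in the group algebra, applied to the
generator, returns `v`. With `spechtBoxEmb_rep` it is all that the retraction onto the isotypic
piece needs. -/
theorem sum_coeff_smul_spechtBoxRep (v : ⨂[ℂ] i, Specht (lam i)) :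
    ∑ g, (spechtBoxEmb lam v).coeff g • spechtBoxRep lam g (spechtBoxGen lam) = v := by
  classical
  induction v using PiTensorProduct.induction_on with
  | smul_tprod r x =>
    simp only [map_smul, coeff_smul, Finsupp.smul_apply, smul_assoc, ← Finset.smul_sum]
    congr 1
    conv_rhs => rw [← funext fun i => sum_coeff_smul_spechtRep (x i), MultilinearMap.map_sum]
    refine Finset.sum_congr rfl fun g _ => ?_
    rw [MultilinearMap.map_smul_univ, spechtBoxEmb_tprod, coeff_boxProd, spechtBoxGen,
      spechtBoxRep_tprod]
  | add v w hv hw =>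
    simp only [(spechtBoxEmb lam).map_add, coeff_add, Finsupp.add_apply, add_smul,
      Finset.sum_add_distrib, hv, hw]

end YoungDiagram

/-! ### Triangular families of projective objects -/

namespace CategoryTheory

variable {C : Type*} [Category* C] [Abelian C]

attribute [local instance] Abelian.hasFiniteBiproducts

/-- An indecomposable object which has a nonzero retract is isomorphic to it. -/
theorem nonempty_iso_of_indecomposable {M X : C} (hM : Indecomposable M) (hX : ¬ IsZero X)
    (s : X ⟶ M) (r : M ⟶ X) (h : s ≫ r = 𝟙 X) : Nonempty (M ≅ X) := by
  have : IsSplitMono s := ⟨⟨⟨r, h⟩⟩⟩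
  let b := binaryBiconeOfIsSplitMonoOfCokernel (cokernelIsCokernel s)
  have hb : b.IsBilimit := isBilimitBinaryBiconeOfIsSplitMonoOfCokernel (cokernelIsCokernel s)
  have hQ := (hM.2 X (cokernel s) (biprod.uniqueUpToIso _ _ hb)).resolve_left hX
  have : Epi s := Preadditive.epi_of_isZero_cokernel s hQ
  have : IsIso s := isIso_of_mono_of_epi s
  exact ⟨(asIso s).symm⟩

/-- A family of projective objects that generates the category, with division rings of
endomorphisms, and with the other morphisms between its members strictly increasing a rank. -/
structure IsTriangularFamily {ι : Type} (X : ι → C) (v : ι → ℕ) : Prop where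
  projective : ∀ i, Projective (X i)
  not_isZero : ∀ i, ¬ IsZero (X i)
  endo : ∀ i (f : X i ⟶ X i), f = 0 ∨ IsIso f
  lt : ∀ i j (f : X i ⟶ X j), f ≠ 0 → i ≠ j → v i < v j
  cover : ∀ M : C, ∃ (J : Type) (_ : Finite J) (k : J → ι) (p : ∀ j, X (k j) ⟶ M),
    ∀ (Y : C) (g : M ⟶ Y), (∀ j, p j ≫ g = 0) → g = 0

namespace IsTriangularFamily

variable {ι : Type} {X : ι → C} {v : ι → ℕ} (h : IsTriangularFamily X v)

include h in
-- The projection onto a summand is an endomorphism. If it is zero that summand vanishes; if it is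
-- invertible the other one does.
theorem indecomposable (i : ι) : Indecomposable (X i) := by
  refine ⟨h.not_isZero i, fun Y Z e => ?_⟩
  rcases h.endo i (e.hom ≫ biprod.fst ≫ biprod.inl ≫ e.inv) with h' | h'
  · left
    have h1 : (biprod.fst : Y ⊞ Z ⟶ Y) ≫ (biprod.inl : Y ⟶ Y ⊞ Z) = 0 := by
      have := congrArg (fun f => e.inv ≫ f ≫ e.hom) h'
      simpa using this
    rw [IsZero.iff_id_eq_zero]
    have := congrArg (fun f => biprod.inl ≫ f ≫ biprod.fst) h1
    simpa using this
  · right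
    have h1 : (biprod.inr ≫ e.inv : Z ⟶ X i) = 0 := by
      rw [← cancel_mono (e.hom ≫ biprod.fst ≫ biprod.inl ≫ e.inv)]
      simp
    have h2 := congrArg (fun f => f ≫ e.hom ≫ biprod.snd) h1
    rw [IsZero.iff_id_eq_zero]
    simpa using h2

include h in
theorem eq_of_iso {i j : ι} (e : X i ≅ X j) : i = j := by
  by_contra hij
  have h1 : e.hom ≠ 0 := fun h0 => h.not_isZero i
    (by rw [IsZero.iff_id_eq_zero, ← e.hom_inv_id, h0, zero_comp])
  have h2 : e.inv ≠ 0 := fun h0 => h.not_isZero i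
    (by rw [IsZero.iff_id_eq_zero, ← e.hom_inv_id, h0, comp_zero])
  exact lt_asymm (h.lt i j _ h1 hij) (h.lt j i _ h2 (Ne.symm hij))

include h in
theorem le_of_ne_zero {i j : ι} (f : X i ⟶ X j) (hf : f ≠ 0) : v i ≤ v j := by
  by_cases hij : i = j
  · rw [hij]
  · exact (h.lt i j f hf hij).le

include h in
theorem eq_and_isIso_of_le {i j : ι} (f : X i ⟶ X j) (hf : f ≠ 0) (hv : v j ≤ v i) :
    i = j ∧ IsIso f := by
  by_cases hij : i = j
  · subst hij
    exact ⟨rfl, (h.endo i f).resolve_left hf⟩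
  · exact absurd (h.lt i j f hf hij) (not_lt.2 hv)

theorem projective_biproduct {J : Type} [Finite J] (F : J → C) [∀ j, Projective (F j)] :
    Projective (⨁ F) where
  factors f e _ := ⟨biproduct.desc fun j => Projective.factorThru (biproduct.ι F j ≫ f) e,
    biproduct.hom_ext' _ _ fun j => by simp⟩

theorem exists_eq_sum {J : Type} [Fintype J] {F : J → C} {M : C} (p : ∀ j, F j ⟶ M)
    (hp : ∀ (Y : C) (g : M ⟶ Y), (∀ j, p j ≫ g = 0) → g = 0) {N : C} [Projective N]
    (f : N ⟶ M) : ∃ g : ∀ j, N ⟶ F j, f = ∑ j, g j ≫ p j := by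
  have : Epi (biproduct.desc p) :=
    Preadditive.epi_of_cancel_zero _ fun {Y} g hg => hp Y g fun j => by
    rw [← biproduct.ι_desc p j, Category.assoc, hg, comp_zero]
  refine ⟨fun j => Projective.factorThru f (biproduct.desc p) ≫ biproduct.π F j, ?_⟩
  conv_lhs => rw [← Projective.factorThru_comp f (biproduct.desc p)]; rhs; rw [biproduct.desc_eq]
  rw [Preadditive.comp_sum]
  simp only [Category.assoc]

include h in
theorem exists_iso_of_projective (M : C) [Projective M] (hM : Indecomposable M) :
    ∃ i, Nonempty (M ≅ X i) := by
  classical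
  obtain ⟨J, _, k, p, hp⟩ := h.cover M
  cases nonempty_fintype J
  have hne : (Finset.univ.filter fun j => p j ≠ 0).Nonempty := by
    by_contra h0
    rw [Finset.not_nonempty_iff_eq_empty, Finset.filter_eq_empty_iff] at h0
    exact hM.1 ((IsZero.iff_id_eq_zero M).2 (hp M (𝟙 M) fun j => by
      rw [Category.comp_id]; exact not_not.1 (h0 (Finset.mem_univ j))))
  -- Factor the identity of `M` through the cover. Some composite `p j₀ ≫ g j` into a member with `p
  -- j ≠ 0` is nonzero; as `v (k j₀)` is maximal it is invertible, so `X (k j₀)` is a retract of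
  -- `M`.
  obtain ⟨j₀, hj₀, hmax⟩ := Finset.exists_max_image _ (fun j => v (k j)) hne
  obtain ⟨g, hg⟩ := exists_eq_sum p hp (𝟙 M)
  have h0 : p j₀ = ∑ j, (p j₀ ≫ g j) ≫ p j := by
    conv_lhs => rw [← Category.comp_id (p j₀), hg, Preadditive.comp_sum]
    simp only [Category.assoc]
  obtain ⟨j, hj⟩ : ∃ j, (p j₀ ≫ g j) ≫ p j ≠ 0 := by
    by_contra! hz
    rw [Finset.sum_eq_zero fun j _ => hz j] at h0
    exact (Finset.mem_filter.1 hj₀).2 h0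
  have hpj : p j ≠ 0 := fun h' => hj (by rw [h', comp_zero])
  have hgj : p j₀ ≫ g j ≠ 0 := fun h' => hj (by rw [h', zero_comp])
  obtain ⟨-, hi⟩ := h.eq_and_isIso_of_le _ hgj (hmax j (by simpa using hpj))
  exact ⟨k j₀, nonempty_iso_of_indecomposable hM (h.not_isZero _) (p j₀)
    (g j ≫ inv (p j₀ ≫ g j)) (by rw [← Category.assoc, IsIso.hom_inv_id])⟩

section Resolution

variable (P : C → Prop) (hiso : ∀ A B : C, (A ≅ B) → P A → P B)
  (hproj : ∀ A : C, Projective A → P A)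
  (h₃ : ∀ S : ShortComplex C, S.ShortExact → P S.X₁ → P S.X₂ → P S.X₃)
  (h₂ : ∀ S : ShortComplex C, S.ShortExact → P S.X₁ → P S.X₃ → P S.X₂)

include hiso h₂ h₃ in
-- The coimage is handled by the sequence kernel, source, coimage; `M` is then an extension of the
-- cokernel by the image.
theorem of_kernel_of_cokernel {Y M : C} (q : Y ⟶ M) (hY : P Y) (hK : P (kernel q))
    (hQ : P (cokernel q)) : P M := by
  have e₁ : (ShortComplex.mk (kernel.ι q) (cokernel.π (kernel.ι q))
      (cokernel.condition _)).ShortExact :=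
    { exact := ShortComplex.exact_cokernel _ }
  have e₂ : (ShortComplex.mk (kernel.ι (cokernel.π q)) (cokernel.π q)
      (kernel.condition _)).ShortExact :=
    { exact := ShortComplex.exact_kernel _ }
  exact h₂ _ e₂ (hiso _ _ (Abelian.coimageIsoImage q) (h₃ _ e₁ hK hY)) hQ

variable {P}

include h hiso hproj h₂ h₃ in
-- The hypothesis says that all ranks visible in `M` are below `D`. A minimal family generating the
-- top rank gives a map from a projective whose kernel and cokernel see only smaller ranks.
theorem induction_rank (D : ℕ) : ∀ M : C, (∀ i (f : X i ⟶ M), D ≤ v i → f = 0) → P M := by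
  classical
  induction D with
  | zero =>
    intro M hM
    obtain ⟨J, _, k, p, hp⟩ := h.cover M
    refine hproj M (IsZero.projective ((IsZero.iff_id_eq_zero M).2 (hp M (𝟙 M) fun j => ?_)))
    rw [hM _ (p j) (Nat.zero_le _), zero_comp]
  | succ D ih =>
    intro M hM
    obtain ⟨J, _, k, p, hp⟩ := h.cover M
    cases nonempty_fintype J
    have hX := h.projective
    -- A good set of generators has rank exactly `D` and suffices to factor every map to `M` from a
    -- member of rank `D`.
    let good : Finset J → Prop := fun S => (∀ j ∈ S, v (k j) = D) ∧
      ∀ i, v i = D → ∀ f : X i ⟶ M, ∃ g : ∀ j, X i ⟶ X (k j), f = ∑ j ∈ S, g j ≫ p j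
    have hgood : good (Finset.univ.filter fun j => v (k j) = D) := by
      refine ⟨fun j hj => by simpa using hj, fun i hi f => ?_⟩
      obtain ⟨g, hg⟩ := exists_eq_sum p hp f
      refine ⟨g, ?_⟩
      rw [hg, Finset.sum_filter]
      refine Finset.sum_congr rfl fun j _ => ?_
      split_ifs with hj
      · rfl
      · by_cases hgj : g j = 0
        · rw [hgj, zero_comp]
        · have := h.le_of_ne_zero _ hgj
          rw [hM _ (p j) (by omega), comp_zero]
    obtain ⟨S, hS, hmin⟩ := (measure (Finset.card (α := J))).wf.has_min {S | good S} ⟨_, hgood⟩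
    obtain ⟨hSD, hSg⟩ : good S := hS
    let q : (⨁ fun j : S => X (k j)) ⟶ M := biproduct.desc fun j => p j
    refine of_kernel_of_cokernel P hiso h₃ h₂ q (hproj _ (projective_biproduct _))
      (ih _ ?_) (ih _ ?_)
    -- Kernel: a nonzero map from rank at least `D` has a nonzero component at some `j` in `S`,
    -- necessarily invertible. The relation that it gives expresses `p j` through the other
    -- generators, contradicting minimality.
    · intro i f hi
      by_contra hf
      have ht : f ≫ kernel.ι q ≠ 0 := fun h0 =>
        hf ((cancel_mono (kernel.ι q)).1 (by rw [h0, zero_comp]))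
      obtain ⟨j, hj⟩ : ∃ j, (f ≫ kernel.ι q) ≫ biproduct.π _ j ≠ 0 := by
        by_contra! hz
        exact ht (biproduct.hom_ext _ _ fun j => by rw [hz, zero_comp])
      obtain ⟨hij, hiso'⟩ := h.eq_and_isIso_of_le _ hj ((hSD _ j.2).trans_le hi)
      let t : ∀ l : J, X i ⟶ X (k l) := fun l =>
        if hl : l ∈ S then (f ≫ kernel.ι q) ≫ biproduct.π _ (⟨l, hl⟩ : S) else 0
      have ht' : ∀ l : S, t l = (f ≫ kernel.ι q) ≫ biproduct.π _ l := fun l => dif_pos l.2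
      have htq : ∑ l ∈ S, t l ≫ p l = 0 := by
        have : (f ≫ kernel.ι q) ≫ q = 0 := by rw [Category.assoc, kernel.condition, comp_zero]
        rw [← this, ← Finset.sum_coe_sort S]
        conv_rhs => rhs; rw [show q = biproduct.desc fun j : S => p j from rfl, biproduct.desc_eq]
        rw [Preadditive.comp_sum]
        simp only [ht', Category.assoc]
      rw [← ht'] at hiso'
      have hpj : p j = ∑ l ∈ S.erase j, (-inv (t j) ≫ t l) ≫ p l := by
        rw [← Finset.add_sum_erase _ _ j.2] at htq
        have := congrArg (fun z => inv (t j) ≫ z) htq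
        simp only [Preadditive.comp_add, IsIso.inv_hom_id_assoc, comp_zero,
          Preadditive.comp_sum] at this
        rw [eq_neg_of_add_eq_zero_left this, ← Finset.sum_neg_distrib]
        simp
      refine hmin (S.erase j) ⟨fun l hl => hSD l (Finset.mem_of_mem_erase hl), fun i' hi' f' => ?_⟩
        (Finset.card_erase_lt_of_mem j.2)
      obtain ⟨g, hg⟩ := hSg i' hi' f'
      refine ⟨fun l => g l + g j ≫ (-inv (t j) ≫ t l), ?_⟩
      rw [hg, ← Finset.add_sum_erase _ _ j.2]
      conv_lhs => lhs; rw [hpj]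
      simp only [Preadditive.comp_sum, Preadditive.add_comp, Finset.sum_add_distrib,
        Category.assoc]
      exact add_comm _ _
    -- Cokernel: lift to `M` by projectivity. The lift factors through `q` in rank `D`, and vanishes
    -- in higher rank.
    · intro i f hi
      have hf := Projective.factorThru_comp f (cokernel.π q)
      rw [← hf]
      rcases hi.eq_or_lt with hi | hi
      · obtain ⟨g, hg⟩ := hSg i hi.symm (Projective.factorThru f (cokernel.π q))
        have : Projective.factorThru f (cokernel.π q) = (biproduct.lift fun j : S => g j) ≫ q := by
          rw [hg, biproduct.lift_desc, Finset.sum_coe_sort S (fun j => g j ≫ p j)]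
        rw [this, Category.assoc, cokernel.condition, comp_zero]
      · rw [hM i (Projective.factorThru f (cokernel.π q)) hi, zero_comp]

include h hiso hproj h₂ h₃ in
/-- Any property of objects which holds for projectives and satisfies two cases of two-out-of-three
in short exact sequences holds for every object. -/
theorem induction_shortExact (M : C) : P M := by
  obtain ⟨J, _, k, p, hp⟩ := h.cover M
  cases nonempty_fintype J
  refine h.induction_rank hiso hproj h₃ h₂ (Finset.univ.sup (fun j => v (k j)) + 1) M
    fun i f hi => ?_
  have := h.projective i
  obtain ⟨g, hg⟩ := exists_eq_sum p hp f
  rw [hg]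
  refine Finset.sum_eq_zero fun j _ => ?_
  have hg0 : g j = 0 := by
    by_contra h0
    have h1 := h.le_of_ne_zero _ h0
    have h2 : v (k j) ≤ Finset.univ.sup (fun j => v (k j)) :=
      Finset.le_sup (f := fun j => v (k j)) (Finset.mem_univ j)
    omega
  rw [hg0, zero_comp]

end Resolution

end IsTriangularFamily

end CategoryTheory

/-! ### Monomorphisms and epimorphisms of modules -/

namespace UMod

open WeightedSet MonoidAlgebra

variable {n : ℕ}

/-- The linear map by which a morphism acts on the value at a weighted set. -/
abbrev appₗ {M N : UMod n} (f : M ⟶ N) (T : WeightedSet n) : M.obj.obj T →ₗ[ℂ] N.obj.obj T :=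
  (f.hom.app T).hom.hom

/-- The linear map induced by a morphism of weighted sets. -/
abbrev mapₗ (M : UMod n) {S T : WeightedSet n} (φ : S ⟶ T) : M.obj.obj S →ₗ[ℂ] M.obj.obj T :=
  (M.obj.map φ).hom.hom

theorem mapₗ_id (M : UMod n) (T : WeightedSet n) (x : M.obj.obj T) : mapₗ M (𝟙 T) x = x := by
  rw [mapₗ, M.obj.map_id]
  rfl

theorem mapₗ_comp (M : UMod n) {R S T : WeightedSet n} (φ : R ⟶ S) (ψ : S ⟶ T)
    (x : M.obj.obj R) : mapₗ M (φ ≫ ψ) x = mapₗ M ψ (mapₗ M φ x) := by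
  rw [mapₗ, M.obj.map_comp]
  rfl

theorem appₗ_mapₗ {M N : UMod n} (f : M ⟶ N) {S T : WeightedSet n} (φ : S ⟶ T)
    (x : M.obj.obj S) : appₗ f T (mapₗ M φ x) = mapₗ N φ (appₗ f S x) :=
  congrArg (fun g => g.hom.hom x) (f.hom.naturality φ)

theorem appₗ_comp {M N P : UMod n} (f : M ⟶ N) (g : N ⟶ P) (T : WeightedSet n)
    (x : M.obj.obj T) : appₗ (f ≫ g) T x = appₗ g T (appₗ f T x) := rfl

/-- A morphism of modules from a natural family of linear maps. -/
def homOfLinear {M N : UMod n} (f : ∀ T, M.obj.obj T →ₗ[ℂ] N.obj.obj T)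
    (hf : ∀ (S T : WeightedSet n) (φ : S ⟶ T) (x : M.obj.obj S),
      f T (mapₗ M φ x) = mapₗ N φ (f S x)) : M ⟶ N :=
  ObjectProperty.homMk
    { app T := FGModuleCat.ofHom (f T)
      naturality S T φ := by
        ext x
        exact hf S T φ x }

theorem hom_ext_apply {M N : UMod n} {f g : M ⟶ N} (h : ∀ T x, appₗ f T x = appₗ g T x) : f = g :=
  hom_ext' fun T => LinearMap.ext (h T)

/-- Kernels in the functor category of maps between modules of finite support again have finite
support. So a monomorphism here is one there, and hence at every value. -/
theorem injective_appₗ {M N : UMod n} (f : M ⟶ N) [Mono f] (T : WeightedSet n) :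
    Function.Injective (appₗ f T) := by
  have : Mono f.hom := by
    let K : UMod n := ⟨kernel f.hom, (HasFiniteSupport n).prop_of_mono (kernel.ι f.hom) M.property⟩
    let k : K ⟶ M := ObjectProperty.homMk (kernel.ι f.hom)
    have hk : k = 0 := by
      rw [← cancel_mono f, zero_comp]
      ext1
      exact kernel.condition f.hom
    exact Preadditive.mono_of_kernel_zero (congrArg (fun z => z.hom) hk)
  have : Mono ((forget₂ (FGModuleCat.{0} ℂ) (ModuleCat ℂ)).map (f.hom.app T)) := inferInstance
  exact (ModuleCat.mono_iff_injective _).1 this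

theorem surjective_appₗ {M N : UMod n} (f : M ⟶ N) [Epi f] (T : WeightedSet n) :
    Function.Surjective (appₗ f T) := by
  have : Epi f.hom := by
    let K : UMod n := ⟨cokernel f.hom,
      (HasFiniteSupport n).prop_of_epi (cokernel.π f.hom) N.property⟩
    let k : N ⟶ K := ObjectProperty.homMk (cokernel.π f.hom)
    have hk : k = 0 := by
      rw [← cancel_epi f, comp_zero]
      ext1
      exact cokernel.condition f.hom
    exact Preadditive.epi_of_cokernel_zero (congrArg (fun z => z.hom) hk)
  have : Epi ((forget₂ (FGModuleCat.{0} ℂ) (ModuleCat ℂ)).map (f.hom.app T)) := inferInstance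
  exact (ModuleCat.epi_iff_surjective _).1 this

/-! ### The isotypic pieces as retracts -/

/-- The value at a weighted set, as a linear map on endomorphisms. -/
def evalEnd (M : UMod n) (T : WeightedSet n) : End M →ₗ[ℂ] Module.End ℂ (M.obj.obj T) where
  toFun f := appₗ f T
  map_add' _ _ := rfl
  map_smul' _ _ := rfl

theorem valueRep_mapₗ {G : Type} [Group G] (M : UMod n) (act : G →* End M)
    {S T : WeightedSet n} (φ : S ⟶ T) (g : G) (x : M.obj.obj S) :
    valueRep M act T g (mapₗ M φ x) = mapₗ M φ (valueRep M act S g x) :=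
  (LinearMap.congr_fun (map_valueRep M act φ g) x).symm

section Retract

variable {G V : Type} [Group G] [Fintype G] [AddCommGroup V] [Module ℂ V] [Module.Finite ℂ V]
  (ρ : Representation ℂ G V) (M : UMod n) (act : G →* End M)

theorem appₗ_lift (x : MonoidAlgebra ℂ G) (T : WeightedSet n) (y : M.obj.obj T) :
    appₗ (lift ℂ (End M) G act x) T y = ∑ g, x.coeff g • valueRep M act T g y := by
  rw [lift_apply, Finsupp.sum_fintype x.coeff (fun g r => r • act g) (fun _ => zero_smul _ _)]
  change evalEnd M T _ y = _
  rw [map_sum, LinearMap.sum_apply]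
  rfl

/-- Evaluation of intertwining maps at a vector. -/
def isotypicEval (w : V) : isotypicPiece ρ M act ⟶ M :=
  homOfLinear (fun T => ({ toFun f := f w, map_add' _ _ := rfl, map_smul' _ _ := rfl } :
    ρ.IntertwiningMap (valueRep M act T) →ₗ[ℂ] M.obj.obj T)) fun _ _ _ _ => rfl

/-- The map to the isotypic piece determined by an equivariant map to the group algebra. -/
def isotypicProj (j : V →ₗ[ℂ] MonoidAlgebra ℂ G) (hj : ∀ g v, j (ρ g v) = of ℂ G g * j v) :
    M ⟶ isotypicPiece ρ M act :=
  homOfLinear (fun T => ({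
    toFun x := ⟨{
      toFun v := ∑ g, (j v).coeff g • valueRep M act T g x
      map_add' v w := by
        simp only [map_add, coeff_add, Finsupp.add_apply, add_smul, Finset.sum_add_distrib]
      map_smul' r v := by
        simp only [map_smul, coeff_smul, Finsupp.smul_apply, smul_assoc, Finset.smul_sum,
          RingHom.id_apply] }, fun h => by
      ext v
      simp only [LinearMap.comp_apply, LinearMap.coe_mk, AddHom.coe_mk, map_sum, map_smul, hj]
      refine Fintype.sum_equiv (Equiv.mulLeft h⁻¹) _ _ fun g => ?_
      rw [of_apply, coeff_single_mul_apply, one_mul, Equiv.coe_mulLeft, ← Module.End.mul_apply,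
        ← map_mul, mul_inv_cancel_left]⟩
    map_add' x y := by
      ext v
      simp only [map_add, smul_add, Finset.sum_add_distrib]
      rfl
    map_smul' r x := by
      ext v
      simp only [map_smul, smul_comm _ r, ← Finset.smul_sum]
      rfl } : M.obj.obj T →ₗ[ℂ] ρ.IntertwiningMap (valueRep M act T))) fun S T φ x => by
    apply Representation.IntertwiningMap.ext
    ext v
    change ∑ g, (j v).coeff g • valueRep M act T g (mapₗ M φ x) =
      mapₗ M φ (∑ g, (j v).coeff g • valueRep M act S g x)
    simp only [valueRep_mapₗ, map_sum, map_smul]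

variable (w : V) (j : V →ₗ[ℂ] MonoidAlgebra ℂ G) (hj : ∀ g v, j (ρ g v) = of ℂ G g * j v)

theorem isotypicProj_eval :
    isotypicProj ρ M act j hj ≫ isotypicEval ρ M act w = lift ℂ (End M) G act (j w) :=
  hom_ext_apply fun T x => (appₗ_lift M act (j w) T x).symm

/-- An intertwining map is determined by its value at `w`, because `hw` writes every `v` as j(v)
applied to `w`. -/
theorem isotypicEval_proj (hw : ∀ v, ∑ g, (j v).coeff g • ρ g w = v) :
    isotypicEval ρ M act w ≫ isotypicProj ρ M act j hj = 𝟙 _ := by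
  refine hom_ext_apply fun T (f : ρ.IntertwiningMap (valueRep M act T)) => ?_
  apply Representation.IntertwiningMap.ext
  ext v
  change ∑ g, (j v).coeff g • valueRep M act T g (f w) = f v
  conv_rhs => rw [← hw v]
  rw [map_sum]
  refine Finset.sum_congr rfl fun g _ => ?_
  rw [map_smul, f.isIntertwining]

end Retract

end UMod

/-! ### Families on which the symmetric groups act with regular endomorphism algebras -/

namespace UMod

open WeightedSet MonoidAlgebra YoungDiagram

variable {n : ℕ}

/-- A family of modules indexed by the standard weighted sets whose endomorphism algebras are the
group algebras of the automorphism groups, and whose morphisms come from upwards bijections. -/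
structure IsRegularFamily (F : (Fin n → ℕ) → UMod n)
    (act : ∀ a : Fin n → ℕ, (∀ i, Equiv.Perm (Fin (a i))) →* End (F a)) : Prop where
  bijective : ∀ a, Function.Bijective (lift ℂ (End (F a)) _ (act a))
  nonempty_hom : ∀ a b (f : F a ⟶ F b), f ≠ 0 → Nonempty (std b ⟶ std a)

/-- The isotypic piece of `F a` for the external product of Specht modules. -/
abbrev spechtPiece (F : (Fin n → ℕ) → UMod n)
    (act : ∀ a : Fin n → ℕ, (∀ i, Equiv.Perm (Fin (a i))) →* End (F a))
    (lam : Fin n → YoungDiagram) : UMod n :=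
  isotypicPiece (V := ⨂[ℂ] i, Specht (lam i)) (spechtBoxRep lam) (F fun i => (lam i).card) (act _)

variable (F : (Fin n → ℕ) → UMod n)
  (act : ∀ a : Fin n → ℕ, (∀ i, Equiv.Perm (Fin (a i))) →* End (F a))

/-- The section evaluates at the generator of the Specht product; the retraction sends x to the map
v ↦ j(v)·x. Allowing `a` to be merely equal to the sizes lets two pieces be compared inside one `F
a`. -/
theorem exists_retract (lam : Fin n → YoungDiagram) (a : Fin n → ℕ) (h : ∀ i, (lam i).card = a i) :
    ∃ (s : spechtPiece F act lam ⟶ F a) (r : F a ⟶ spechtPiece F act lam), s ≫ r = 𝟙 _ ∧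
      r ≫ s = lift ℂ (End (F a)) _ (act a) (boxIdem fun i => tableauOfCard (lam i) (h i)) := by
  obtain rfl : a = fun i => (lam i).card := funext fun i => (h i).symm
  refine ⟨isotypicEval _ _ _ (spechtBoxGen lam),
    isotypicProj _ _ _ (spechtBoxEmb lam) (spechtBoxEmb_rep lam),
    isotypicEval_proj _ _ _ _ _ _ (sum_coeff_smul_spechtBoxRep lam), ?_⟩
  rw [isotypicProj_eval, spechtBoxEmb_gen]
  rfl

theorem comp_comp_ne_zero_of_retract {X Y : UMod n} {a b : Fin n → ℕ} {s : X ⟶ F a} {r : F a ⟶ X}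
    (hs : s ≫ r = 𝟙 X) {s' : Y ⟶ F b} {r' : F b ⟶ Y} (hs' : s' ≫ r' = 𝟙 Y) {f : X ⟶ Y}
    (hf : f ≠ 0) : r ≫ f ≫ s' ≠ 0 := by
  intro h0
  have := congrArg (fun z => s ≫ z ≫ r') h0
  simp only [Category.assoc, hs', Category.comp_id, zero_comp, comp_zero] at this
  rw [← Category.assoc, hs, Category.id_comp] at this
  exact hf this

variable {F act} (hF : IsRegularFamily F act)
include hF

theorem IsRegularFamily.not_isZero (lam : Fin n → YoungDiagram) :
    ¬ IsZero (spechtPiece F act lam) := by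
  obtain ⟨s, r, -, hrs⟩ := exists_retract F act lam _ fun i => rfl
  intro h0
  rw [h0.eq_zero_of_tgt r, zero_comp] at hrs
  exact boxIdem_ne_zero _ ((hF.bijective _).1 (hrs.symm.trans (map_zero _).symm))

/-- Maps between two summands of one `F a` form a corner e_μ A e_λ. The order is reversed because
multiplication in `End` is composition written backwards. -/
theorem IsRegularFamily.exists_conj {lam mu : Fin n → YoungDiagram} {a : Fin n → ℕ}
    (h : ∀ i, (lam i).card = a i) (h' : ∀ i, (mu i).card = a i)
    {s : spechtPiece F act lam ⟶ F a} {r : F a ⟶ spechtPiece F act lam} (hs : s ≫ r = 𝟙 _)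
    (hr : r ≫ s = lift ℂ (End (F a)) _ (act a) (boxIdem fun i => tableauOfCard (lam i) (h i)))
    {s' : spechtPiece F act mu ⟶ F a} {r' : F a ⟶ spechtPiece F act mu} (hs' : s' ≫ r' = 𝟙 _)
    (hr' : r' ≫ s' = lift ℂ (End (F a)) _ (act a) (boxIdem fun i => tableauOfCard (mu i) (h' i)))
    (f : spechtPiece F act lam ⟶ spechtPiece F act mu) :
    ∃ x, r ≫ f ≫ s' = lift ℂ (End (F a)) _ (act a)
      ((boxIdem fun i => tableauOfCard (mu i) (h' i)) * x *
        boxIdem fun i => tableauOfCard (lam i) (h i)) := by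
  obtain ⟨x, hx⟩ := (hF.bijective a).2 (r ≫ f ≫ s')
  refine ⟨x, ?_⟩
  rw [map_mul, map_mul, hx, ← hr, ← hr', End.mul_def, End.mul_def]
  simp only [Category.assoc, reassoc_of% hs, reassoc_of% hs']

theorem IsRegularFamily.endo (lam : Fin n → YoungDiagram)
    (f : spechtPiece F act lam ⟶ spechtPiece F act lam) : f = 0 ∨ IsIso f := by
  obtain ⟨s, r, hs, hr⟩ := exists_retract F act lam _ fun i => rfl
  obtain ⟨x, hx⟩ := hF.exists_conj _ _ hs hr hs hr f
  obtain ⟨k, hk⟩ := boxIdem_mul_mul_boxIdem (fun i => tableauOfCard (lam i) rfl) x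
  have hf : f = k • 𝟙 _ := by
    rw [hk, map_smul, ← hr] at hx
    have := congrArg (fun z => s ≫ z ≫ r) hx
    have e : s ≫ (r ≫ f ≫ s) ≫ r = f := by
      simp only [Category.assoc, hs, Category.comp_id, reassoc_of% hs]
    have e' : s ≫ (k • (r ≫ s)) ≫ r = k • 𝟙 _ := by
      rw [Linear.smul_comp, Linear.comp_smul, Category.assoc, hs, Category.comp_id, hs]
    exact e.symm.trans (this.trans e')
  by_cases hk0 : k = 0
  · left
    rw [hf, hk0, zero_smul]
  · right
    refine ⟨k⁻¹ • 𝟙 _, ?_, ?_⟩ <;>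
    simp [hf, smul_smul, hk0]

/-- If all sizes agree, both pieces are summands of one `F a`, and the corner between distinct
blocks is zero. -/
theorem IsRegularFamily.hom_of_ne_zero {lam mu : Fin n → YoungDiagram}
    (f : spechtPiece F act lam ⟶ spechtPiece F act mu) (hf : f ≠ 0) (hne : lam ≠ mu) :
    (∃ i, (lam i).card ≠ (mu i).card) ∧
      Nonempty (std (fun i => (mu i).card) ⟶ std fun i => (lam i).card) := by
  obtain ⟨s, r, hs, hr⟩ := exists_retract F act lam _ fun i => rfl
  refine ⟨?_, ?_⟩
  · by_contra! h
    obtain ⟨s', r', hs', hr'⟩ := exists_retract F act mu _ fun i => (h i).symm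
    obtain ⟨x, hx⟩ := hF.exists_conj _ _ hs hr hs' hr' f
    rw [boxIdem_mul_mul_boxIdem_eq_zero _ _ hne.symm, map_zero] at hx
    exact comp_comp_ne_zero_of_retract F hs hs' hf hx
  · obtain ⟨s', r', hs', -⟩ := exists_retract F act mu _ fun i => rfl
    exact hF.nonempty_hom _ _ _ (comp_comp_ne_zero_of_retract F hs hs' hf)

omit hF in
-- Transports the expression of 1 as a combination of products x e y: the identity of `F a` factors
-- through finitely many pieces.
theorem exists_id_eq_sum (a : Fin n → ℕ) :
    ∃ (m : ℕ) (lam : Fin m → Fin n → YoungDiagram) (α : ∀ j, F a ⟶ spechtPiece F act (lam j))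
      (β : ∀ j, spechtPiece F act (lam j) ⟶ F a), 𝟙 (F a) = ∑ j, α j ≫ β j := by
  obtain ⟨m, c, z, hz⟩ := Submodule.mem_span_set'.1 (one_mem_span_boxIdem a)
  choose lam h x y hxy using fun j => (z j).2
  choose s r _ hr using fun j => exists_retract F act (lam j) a (h j)
  refine ⟨m, lam, fun j => c j • (lift ℂ (End (F a)) _ (act a) (y j) ≫ r j),
    fun j => s j ≫ lift ℂ (End (F a)) _ (act a) (x j), ?_⟩
  have := congrArg (lift ℂ (End (F a)) _ (act a)) hz
  rw [map_one, map_sum] at this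
  rw [← End.one_def, ← this]
  refine Finset.sum_congr rfl fun j _ => ?_
  rw [map_smul, hxy, map_mul, map_mul, ← hr, End.mul_def, End.mul_def, Linear.smul_comp]
  simp only [Category.assoc]

end UMod

/-! ### Endomorphisms of standard weighted sets -/

namespace WeightedSet

variable {n : ℕ}

/-- The bijection underlying a morphism of standard weighted sets. -/
def stdEquiv {a b : Fin n → ℕ} (φ : std b ⟶ std a) : (Σ i, Fin (b i)) ≃ Σ i, Fin (a i) := φ.toEquiv

theorem stdEquiv_le {a b : Fin n → ℕ} (φ : std b ⟶ std a) (x : Σ i, Fin (b i)) :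
    x.1 ≤ (stdEquiv φ x).1 := φ.le_weight x

theorem eq_of_forall_fst_eq {a b : Fin n → ℕ} (e : (Σ i, Fin (b i)) ≃ Σ i, Fin (a i))
    (h : ∀ x, (e x).1 = x.1) : b = a := by
  funext i
  have e' : {x : Σ i, Fin (b i) // x.1 = i} ≃ {x : Σ i, Fin (a i) // x.1 = i} :=
    e.subtypeEquiv fun x => by rw [h x]
  have key : ∀ c : Fin n → ℕ, Nat.card {x : Σ i, Fin (c i) // x.1 = i} = c i := fun c =>
    (Nat.card_congr (Equiv.sigmaSubtype i)).trans (Nat.card_fin (c i))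
  rw [← key b, ← key a, Nat.card_congr e']

/-- The total weight of a standard weighted set. -/
def totalWeight (a : Fin n → ℕ) : ℕ := ∑ x : Σ i, Fin (a i), (x.1 : ℕ)

/-- The total coweight of a standard weighted set. -/
def totalCoweight (a : Fin n → ℕ) : ℕ := ∑ x : Σ i, Fin (a i), (n - (x.1 : ℕ))

theorem exists_weight_lt {a b : Fin n → ℕ} (φ : std b ⟶ std a) (h : b ≠ a) :
    ∃ x : Σ i, Fin (b i), x.1 < (stdEquiv φ x).1 := by
  by_contra! h'
  exact h (eq_of_forall_fst_eq (stdEquiv φ) fun x => le_antisymm (h' x) (stdEquiv_le φ x))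

theorem totalWeight_lt {a b : Fin n → ℕ} (φ : std b ⟶ std a) (h : b ≠ a) :
    totalWeight b < totalWeight a := by
  rw [totalWeight, totalWeight, ← (stdEquiv φ).sum_comp]
  obtain ⟨x, hx⟩ := exists_weight_lt φ h
  exact Finset.sum_lt_sum (fun y _ => stdEquiv_le φ y) ⟨x, Finset.mem_univ x, hx⟩

theorem totalCoweight_lt {a b : Fin n → ℕ} (φ : std b ⟶ std a) (h : b ≠ a) :
    totalCoweight a < totalCoweight b := by
  rw [totalCoweight, totalCoweight, ← (stdEquiv φ).sum_comp]
  obtain ⟨x, hx⟩ := exists_weight_lt φ h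
  exact Finset.sum_lt_sum (fun y _ => Nat.sub_le_sub_left (stdEquiv_le φ y) n)
    ⟨x, Finset.mem_univ x, Nat.sub_lt_sub_left x.1.2 hx⟩

/-- No weight decreases, and the permutation preserves their sum, so no weight changes. -/
theorem stdEquiv_fst {a : Fin n → ℕ} (φ : std a ⟶ std a) (x : Σ i, Fin (a i)) :
    (stdEquiv φ x).1 = x.1 := by
  have h := (stdEquiv φ).sum_comp fun y => (y.1 : ℕ)
  exact Fin.ext ((Finset.sum_eq_sum_iff_of_le (f := fun y : Σ i, Fin (a i) => (y.1 : ℕ))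
    (g := fun y => ((stdEquiv φ y).1 : ℕ)) fun y _ => stdEquiv_le φ y).1 h.symm x
    (Finset.mem_univ x)).symm

theorem exists_stdAct {a : Fin n → ℕ} (φ : std a ⟶ std a) : ∃ g, stdAct a g = φ := by
  have h : ∀ i (x : Fin (a i)), ∃ y : Fin (a i), stdEquiv φ ⟨i, x⟩ = ⟨i, y⟩ := by
    intro i x
    have h1 := stdEquiv_fst φ ⟨i, x⟩
    generalize stdEquiv φ ⟨i, x⟩ = z at h1
    obtain ⟨j, y⟩ := z
    obtain rfl : j = i := h1
    exact ⟨y, rfl⟩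
  choose f hf using h
  have hinj : ∀ i, Function.Injective (f i) := fun i x y hxy => by
    have h1 : stdEquiv φ ⟨i, x⟩ = stdEquiv φ ⟨i, y⟩ := by rw [hf, hf, hxy]
    exact eq_of_heq (Sigma.mk.inj ((stdEquiv φ).injective h1)).2
  refine ⟨fun i => Equiv.ofBijective (f i) (Finite.injective_iff_bijective.1 (hinj i)), ?_⟩
  ext ⟨i, x⟩
  exact (hf i x).symm

theorem stdAct_injective (a : Fin n → ℕ) : Function.Injective (stdAct a) := by
  intro g h hgh
  funext i
  refine Equiv.ext fun x => ?_
  have h1 : (⟨i, g i x⟩ : Σ i, Fin (a i)) = ⟨i, h i x⟩ :=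
    congrArg (fun φ : std a ⟶ std a => stdEquiv φ ⟨i, x⟩) hgh
  exact eq_of_heq (Sigma.mk.inj h1).2

/-- Group elements, acting through their inverses, are the endomorphisms of a standard set. -/
def stdActEquiv (a : Fin n → ℕ) : (∀ i, Equiv.Perm (Fin (a i))) ≃ (std a ⟶ std a) :=
  (Equiv.inv _).trans (Equiv.ofBijective (stdAct a) ⟨stdAct_injective a, exists_stdAct⟩)

end WeightedSet

namespace UMod

open WeightedSet MonoidAlgebra YoungDiagram

variable {n : ℕ}

/-- The group algebra, in terms of endomorphisms of a standard weighted set. -/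
def groupAlgebraEquiv (a : Fin n → ℕ) :
    MonoidAlgebra ℂ (∀ i, Equiv.Perm (Fin (a i))) ≃ₗ[ℂ] ((std a ⟶ std a) →₀ ℂ) :=
  (coeffLinearEquiv ℂ).trans (Finsupp.domLCongr (M := ℂ) (R := ℂ) (stdActEquiv a))

theorem groupAlgebraEquiv_apply (a : Fin n → ℕ)
    (x : MonoidAlgebra ℂ (∀ i, Equiv.Perm (Fin (a i)))) :
    groupAlgebraEquiv a x = ∑ g, x.coeff g • Finsupp.single (stdAct a g⁻¹) 1 := by
  conv_lhs => rw [eq_sum_single x]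
  rw [map_sum]
  refine Finset.sum_congr rfl fun g _ => ?_
  rw [map_smul]
  exact congrArg (x.coeff g • ·) (Finsupp.domLCongr_single (M := ℂ) (R := ℂ) (stdActEquiv a) g 1)

/-! ### Principal projectives -/

/-- The morphism out of a principal projective determined by an element. -/
def projDesc {M : UMod n} {a : Fin n → ℕ} (x : M.obj.obj (std a)) : principalProjective a ⟶ M :=
  homOfLinear (fun T => (Finsupp.linearCombination ℂ fun φ : std a ⟶ T => mapₗ M φ x :
    ((std a ⟶ T) →₀ ℂ) →ₗ[ℂ] M.obj.obj T)) fun S T φ y => by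
      have h : (Finsupp.linearCombination ℂ fun ψ : std a ⟶ T => mapₗ M ψ x) ∘ₗ
          (Finsupp.lmapDomain ℂ ℂ fun ψ : std a ⟶ S => ψ ≫ φ) =
          mapₗ M φ ∘ₗ Finsupp.linearCombination ℂ fun ψ : std a ⟶ S => mapₗ M ψ x := by
        ext ψ
        simp [mapₗ_comp]
      exact LinearMap.congr_fun h y

/-- The universal element of a principal projective. -/
def projGen (a : Fin n → ℕ) : (principalProjective a).obj.obj (std a) :=
  (Finsupp.single (𝟙 (std a)) 1 : (std a ⟶ std a) →₀ ℂ)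

theorem appₗ_projDesc_gen {M : UMod n} {a : Fin n → ℕ} (x : M.obj.obj (std a)) :
    appₗ (projDesc x) (std a) (projGen a) = x :=
  (Finsupp.linearCombination_single (v := fun φ : std a ⟶ std a => mapₗ M φ x) ℂ 1
    (𝟙 (std a))).trans (by rw [one_smul, mapₗ_id])

/-- Yoneda: every basis element of P_a(T) is the image of the universal element under its own
morphism. -/
theorem proj_hom_ext {M : UMod n} {a : Fin n → ℕ} {f g : principalProjective a ⟶ M}
    (h : appₗ f (std a) (projGen a) = appₗ g (std a) (projGen a)) : f = g := by
  refine hom_ext' fun T => Finsupp.lhom_ext' fun φ => LinearMap.ext_ring ?_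
  have e : (Finsupp.single φ 1 : (std a ⟶ T) →₀ ℂ) =
      mapₗ (principalProjective a) φ (projGen a) := by
    refine Eq.trans ?_ (Finsupp.mapDomain_single (f := fun ψ : std a ⟶ std a => ψ ≫ φ)).symm
    rw [Category.id_comp]
  change appₗ f T (Finsupp.single φ 1 : (std a ⟶ T) →₀ ℂ) =
    appₗ g T (Finsupp.single φ 1 : (std a ⟶ T) →₀ ℂ)
  rw [e]
  exact (appₗ_mapₗ f φ _).trans ((congrArg _ h).trans (appₗ_mapₗ g φ _).symm)

instance (a : Fin n → ℕ) : Projective (principalProjective a) where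
  factors {E N} f e _ := by
    obtain ⟨x, hx⟩ := surjective_appₗ e (std a) (appₗ f (std a) (projGen a))
    refine ⟨projDesc x, proj_hom_ext ?_⟩
    rw [appₗ_comp, appₗ_projDesc_gen, hx]

theorem appₗ_lift_projGen (a : Fin n → ℕ) (x : MonoidAlgebra ℂ (∀ i, Equiv.Perm (Fin (a i)))) :
    appₗ (lift ℂ (End (principalProjective a)) _ (principalProjectiveAct a) x) (std a)
      (projGen a) = groupAlgebraEquiv a x := by
  rw [appₗ_lift, groupAlgebraEquiv_apply]
  refine Finset.sum_congr rfl fun g _ => ?_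
  congr 1
  refine (Finsupp.mapDomain_single (f := fun φ : std a ⟶ std a => stdAct a g⁻¹ ≫ φ)).trans ?_
  rw [Category.comp_id]

theorem isRegularFamily_proj :
    IsRegularFamily (n := n) principalProjective principalProjectiveAct where
  bijective a := by
    constructor
    · intro x y h
      apply (groupAlgebraEquiv a).injective
      rw [← appₗ_lift_projGen, ← appₗ_lift_projGen, h]
    · intro f
      obtain ⟨x, hx⟩ := (groupAlgebraEquiv a).surjective (appₗ f (std a) (projGen a))
      exact ⟨x, proj_hom_ext ((appₗ_lift_projGen a x).trans hx)⟩
  nonempty_hom a b f hf := by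
    by_contra h
    rw [not_nonempty_iff] at h
    have : Subsingleton ((std b ⟶ std a) →₀ ℂ) := inferInstance
    exact hf (proj_hom_ext (Subsingleton.elim (α := (std b ⟶ std a) →₀ ℂ) _ _))

/-! ### Principal injectives -/

/-- The morphism into a principal injective determined by a functional. -/
def injLift {M : UMod n} {a : Fin n → ℕ} (ξ : Module.Dual ℂ (M.obj.obj (std a))) :
    M ⟶ principalInjective a :=
  homOfLinear (fun T => ({
      toFun m := Finsupp.linearCombination ℂ fun φ : T ⟶ std a => ξ (mapₗ M φ m)
      map_add' m m' := by ext φ; simp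
      map_smul' r m := by ext φ; simp } :
    M.obj.obj T →ₗ[ℂ] Module.Dual ℂ ((T ⟶ std a) →₀ ℂ))) fun S T φ m => by
      change Finsupp.linearCombination ℂ (fun ψ : T ⟶ std a => ξ (mapₗ M ψ (mapₗ M φ m))) =
        Finsupp.linearCombination ℂ (fun ψ : S ⟶ std a => ξ (mapₗ M ψ m)) ∘ₗ
          Finsupp.lmapDomain ℂ ℂ fun ψ : T ⟶ std a => φ ≫ ψ
      ext ψ
      simp [mapₗ_comp]

/-- The universal functional on a principal injective. -/
def injCogen (a : Fin n → ℕ) : Module.Dual ℂ ((principalInjective a).obj.obj (std a)) :=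
  (LinearMap.applyₗ (Finsupp.single (𝟙 (std a)) 1 : (std a ⟶ std a) →₀ ℂ) :
    Module.Dual ℂ ((std a ⟶ std a) →₀ ℂ) →ₗ[ℂ] ℂ)

theorem injCogen_injLift {M : UMod n} {a : Fin n → ℕ} (ξ : Module.Dual ℂ (M.obj.obj (std a)))
    (x : M.obj.obj (std a)) : injCogen a (appₗ (injLift ξ) (std a) x) = ξ x :=
  (Finsupp.linearCombination_single ℂ 1 (𝟙 (std a))).trans (by rw [one_smul, mapₗ_id])

theorem inj_hom_ext {M : UMod n} {a : Fin n → ℕ} {f g : M ⟶ principalInjective a}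
    (h : ∀ x, injCogen a (appₗ f (std a) x) = injCogen a (appₗ g (std a) x)) : f = g := by
  refine hom_ext_apply fun T m => Finsupp.lhom_ext' fun φ => LinearMap.ext_ring ?_
  have e : ∀ u : Module.Dual ℂ ((T ⟶ std a) →₀ ℂ), u (Finsupp.single φ 1) =
      injCogen a (mapₗ (principalInjective a) φ u) := fun u => by
    refine congrArg u (Eq.trans ?_
      (Finsupp.mapDomain_single (f := fun ψ : std a ⟶ std a => φ ≫ ψ)).symm)
    rw [Category.comp_id]
  refine (e _).trans (Eq.trans ?_ (e _).symm)
  refine (congrArg _ (appₗ_mapₗ f φ m).symm).trans ((h _).trans (congrArg _ (appₗ_mapₗ g φ m)))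

instance (a : Fin n → ℕ) : Injective (principalInjective a) where
  factors {M N} f e _ := by
    obtain ⟨l, hl⟩ := (appₗ e (std a)).exists_leftInverse_of_injective
      (LinearMap.ker_eq_bot.2 (injective_appₗ e (std a)))
    refine ⟨injLift ((injCogen a ∘ₗ appₗ f (std a)) ∘ₗ l), inj_hom_ext fun x => ?_⟩
    rw [appₗ_comp, injCogen_injLift]
    exact congrArg (fun y => injCogen a (appₗ f (std a) y)) (LinearMap.congr_fun hl x)

theorem injCogen_lift (a : Fin n → ℕ) (x : MonoidAlgebra ℂ (∀ i, Equiv.Perm (Fin (a i))))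
    (u : Module.Dual ℂ ((std a ⟶ std a) →₀ ℂ)) :
    injCogen a (appₗ (lift ℂ (End (principalInjective a)) _ (principalInjectiveAct a) x) (std a) u)
      = u (groupAlgebraEquiv a x) := by
  refine (congrArg (injCogen a) (appₗ_lift _ (principalInjectiveAct a) x (std a) u)).trans ?_
  rw [groupAlgebraEquiv_apply, map_sum, map_sum]
  refine Finset.sum_congr rfl fun g _ => ?_
  rw [map_smul, map_smul]
  congr 1
  refine congrArg u
    ((Finsupp.mapDomain_single (f := fun φ : std a ⟶ std a => φ ≫ stdAct a g⁻¹)).trans ?_)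
  rw [Category.id_comp]

/-- Endomorphisms of I_a are functionals on I_a(a) = ℂ[End(a)]^*. By finite dimension this double
dual is ℂ[End(a)], that is, the group algebra. -/
theorem isRegularFamily_inj :
    IsRegularFamily (n := n) principalInjective principalInjectiveAct where
  bijective a := by
    constructor
    · intro x y h
      apply (groupAlgebraEquiv a).injective
      apply (Module.evalEquiv ℂ ((std a ⟶ std a) →₀ ℂ)).injective
      ext1 u
      refine (injCogen_lift a x u).symm.trans (Eq.trans ?_ (injCogen_lift a y u))
      rw [h]
    · intro f
      obtain ⟨z, hz⟩ := (Module.evalEquiv ℂ ((std a ⟶ std a) →₀ ℂ)).surjective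
        (injCogen a ∘ₗ appₗ f (std a))
      obtain ⟨x, rfl⟩ := (groupAlgebraEquiv a).surjective z
      exact ⟨x, inj_hom_ext fun u => (injCogen_lift a x u).trans (LinearMap.congr_fun hz u)⟩
  nonempty_hom a b f hf := by
    by_contra h
    rw [not_nonempty_iff] at h
    refine hf (inj_hom_ext fun u => ?_)
    have : Subsingleton (Module.Dual ℂ ((std b ⟶ std a) →₀ ℂ)) := inferInstance
    obtain rfl : u = 0 := Subsingleton.elim (α := Module.Dual ℂ ((std b ⟶ std a) →₀ ℂ)) _ _
    rw [map_zero, map_zero]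
    exact (map_zero (injCogen b)).symm

end UMod

/-! ### Generation by the isotypic pieces -/

namespace UMod

open WeightedSet MonoidAlgebra YoungDiagram

variable {n : ℕ}

/-- A module of finite support vanishes outside finitely many standard weighted sets. -/
theorem exists_finite_std (M : UMod n) : ∃ (J : Type) (_ : Finite J) (b : J → Fin n → ℕ),
    ∀ T : WeightedSet n, Nontrivial (M.obj.obj T) → ∃ j, Nonempty (T ≅ std (b j)) := by
  obtain ⟨s, hs, hsM⟩ := M.property
  choose b hb using exists_iso_std (n := n)
  refine ⟨b '' s, hs.image b, fun j => j.1, fun T hT => ?_⟩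
  obtain ⟨S, hS, ⟨f⟩⟩ := hsM T hT
  exact ⟨⟨b S, S, hS, rfl⟩, ⟨f ≪≫ (hb S).some⟩⟩

theorem mapₗ_hom_mapₗ_inv (M : UMod n) {S T : WeightedSet n} (e : S ≅ T) (x : M.obj.obj T) :
    mapₗ M e.hom (mapₗ M e.inv x) = x := by
  rw [← mapₗ_comp, e.inv_hom_id, mapₗ_id]

theorem exists_proj_cover (M : UMod n) : ∃ (J : Type) (_ : Finite J) (b : J → Fin n → ℕ)
    (p : ∀ j, principalProjective (b j) ⟶ M),
    ∀ (Y : UMod n) (g : M ⟶ Y), (∀ j, p j ≫ g = 0) → g = 0 := by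
  obtain ⟨J, _, b, hb⟩ := exists_finite_std M
  -- One principal projective for each basis vector of each value in the support.
  refine ⟨Σ j, Fin (Module.finrank ℂ (M.obj.obj (std (b j)))), inferInstance, fun j => b j.1,
    fun j => projDesc (Module.finBasis ℂ (M.obj.obj (std (b j.1))) j.2), fun Y g hg => ?_⟩
  have hstd : ∀ j, appₗ g (std (b j)) = 0 := fun j =>
    (Module.finBasis ℂ (M.obj.obj (std (b j)))).ext fun i => by
      have h := congrArg (fun f => appₗ f (std (b j)) (projGen (b j))) (hg ⟨j, i⟩)
      rw [appₗ_comp, appₗ_projDesc_gen] at h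
      exact h
  refine hom_ext_apply fun T x => ?_
  by_cases hT : Nontrivial (M.obj.obj T)
  · obtain ⟨j, ⟨e⟩⟩ := hb T hT
    rw [← mapₗ_hom_mapₗ_inv M e.symm x, appₗ_mapₗ, hstd]
    exact map_zero _
  · rw [not_nontrivial_iff_subsingleton] at hT
    obtain rfl : x = 0 := Subsingleton.elim _ _
    rw [map_zero, map_zero]

theorem exists_inj_cover (M : UMod n) : ∃ (J : Type) (_ : Finite J) (b : J → Fin n → ℕ)
    (p : ∀ j, M ⟶ principalInjective (b j)),
    ∀ (Y : UMod n) (g : Y ⟶ M), (∀ j, g ≫ p j = 0) → g = 0 := by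
  obtain ⟨J, _, b, hb⟩ := exists_finite_std M
  refine ⟨Σ j, Fin (Module.finrank ℂ (M.obj.obj (std (b j)))), inferInstance, fun j => b j.1,
    fun j => injLift ((Module.finBasis ℂ (M.obj.obj (std (b j.1)))).coord j.2), fun Y g hg => ?_⟩
  have hstd : ∀ j y, appₗ g (std (b j)) y = 0 := fun j y =>
    (Module.finBasis ℂ (M.obj.obj (std (b j)))).ext_elem fun i => by
      have h := congrArg (fun f => injCogen (b j) (appₗ f (std (b j)) y)) (hg ⟨j, i⟩)
      rw [appₗ_comp, injCogen_injLift] at h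
      rw [map_zero]
      exact h.trans (map_zero (injCogen (b j)))
  refine hom_ext_apply fun T y => ?_
  by_cases hT : Nontrivial (M.obj.obj T)
  · obtain ⟨j, ⟨e⟩⟩ := hb T hT
    rw [← mapₗ_hom_mapₗ_inv Y e.symm y, appₗ_mapₗ, hstd, map_zero]
    exact (appₗ_mapₗ (0 : Y ⟶ M) _ _).trans (map_zero _) |>.symm
  · rw [not_nontrivial_iff_subsingleton] at hT
    exact Subsingleton.elim _ _

variable {F : (Fin n → ℕ) → UMod n}
  {act : ∀ a : Fin n → ℕ, (∀ i, Equiv.Perm (Fin (a i))) →* End (F a)}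

theorem exists_spechtPiece_cover {M : UMod n} {J : Type} [Finite J] {b : J → Fin n → ℕ}
    (p : ∀ j, F (b j) ⟶ M) (hp : ∀ (Y : UMod n) (g : M ⟶ Y), (∀ j, p j ≫ g = 0) → g = 0) :
    ∃ (J : Type) (_ : Finite J) (k : J → Fin n → YoungDiagram)
      (p : ∀ j, spechtPiece F act (k j) ⟶ M),
      ∀ (Y : UMod n) (g : M ⟶ Y), (∀ j, p j ≫ g = 0) → g = 0 := by
  choose m lam α β h using fun j => exists_id_eq_sum (F := F) (act := act) (b j)
  refine ⟨Σ j, Fin (m j), inferInstance, fun x => lam x.1 x.2, fun x => β x.1 x.2 ≫ p x.1,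
    fun Y g hg => hp Y g fun j => ?_⟩
  rw [← Category.id_comp (p j ≫ g), h, Preadditive.sum_comp]
  refine Finset.sum_eq_zero fun i _ => ?_
  have := hg ⟨j, i⟩
  rw [Category.assoc] at this
  rw [Category.assoc, this, comp_zero]

theorem exists_spechtPiece_cocover {M : UMod n} {J : Type} [Finite J] {b : J → Fin n → ℕ}
    (p : ∀ j, M ⟶ F (b j)) (hp : ∀ (Y : UMod n) (g : Y ⟶ M), (∀ j, g ≫ p j = 0) → g = 0) :
    ∃ (J : Type) (_ : Finite J) (k : J → Fin n → YoungDiagram)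
      (p : ∀ j, M ⟶ spechtPiece F act (k j)),
      ∀ (Y : UMod n) (g : Y ⟶ M), (∀ j, g ≫ p j = 0) → g = 0 := by
  choose m lam α β h using fun j => exists_id_eq_sum (F := F) (act := act) (b j)
  refine ⟨Σ j, Fin (m j), inferInstance, fun x => lam x.1 x.2, fun x => p x.1 ≫ α x.1 x.2,
    fun Y g hg => hp Y g fun j => ?_⟩
  rw [← Category.comp_id (g ≫ p j), h, Preadditive.comp_sum]
  refine Finset.sum_eq_zero fun i _ => ?_
  have := hg ⟨j, i⟩
  rw [← Category.assoc] at this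
  rw [← Category.assoc, this, zero_comp]

/-! ### The triangular families of projectives and injectives -/

theorem projective_projectiveOf (lam : Fin n → YoungDiagram) : Projective (projectiveOf lam) := by
  obtain ⟨s, r, hs, -⟩ := exists_retract principalProjective principalProjectiveAct lam _
    fun i => rfl
  exact Retract.projective ⟨s, r, hs⟩

theorem injective_injectiveOf (lam : Fin n → YoungDiagram) : Injective (injectiveOf lam) := by
  obtain ⟨s, r, hs, -⟩ := exists_retract principalInjective principalInjectiveAct lam _
    fun i => rfl
  exact Retract.injective ⟨s, r, hs⟩

theorem isTriangularFamily_projectiveOf :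
    IsTriangularFamily (projectiveOf (n := n)) fun lam => totalCoweight fun i => (lam i).card where
  projective := projective_projectiveOf
  not_isZero := isRegularFamily_proj.not_isZero
  endo := isRegularFamily_proj.endo
  lt lam mu f hf hne := by
    obtain ⟨⟨i, hi⟩, ⟨φ⟩⟩ := isRegularFamily_proj.hom_of_ne_zero f hf hne
    exact totalCoweight_lt φ fun h => hi (congrFun h i).symm
  cover M := by
    obtain ⟨J, _, b, p, hp⟩ := exists_proj_cover M
    exact exists_spechtPiece_cover p hp

/-- Passing to the opposite category reverses the maps, so the rank is the total weight here, where
the projectives use the coweight. -/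
theorem isTriangularFamily_injectiveOf :
    IsTriangularFamily (fun lam => Opposite.op (injectiveOf (n := n) lam))
      fun lam => totalWeight fun i => (lam i).card where
  projective lam := Injective.injective_iff_projective_op.1 (injective_injectiveOf lam)
  not_isZero lam h := isRegularFamily_inj.not_isZero lam h.unop
  endo lam f := by
    rcases isRegularFamily_inj.endo lam f.unop with h | h
    · exact Or.inl (Quiver.Hom.unop_inj h)
    · exact Or.inr ((isIso_unop_iff f).1 h)
  lt lam mu f hf hne := by
    obtain ⟨⟨i, hi⟩, ⟨φ⟩⟩ := isRegularFamily_inj.hom_of_ne_zero f.unop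
      (fun h => hf (Quiver.Hom.unop_inj h)) hne.symm
    exact totalWeight_lt φ fun h => hi (congrFun h i).symm
  cover M := by
    obtain ⟨J, _, b, p, hp⟩ := exists_inj_cover M.unop
    obtain ⟨J, hJ, k, p, hp⟩ :=
      exists_spechtPiece_cocover (act := principalInjectiveAct) p hp
    exact ⟨J, hJ, k, fun j => (p j).op, fun Y g hg => Quiver.Hom.unop_inj
      (hp _ g.unop fun j => congrArg Quiver.Hom.unop (hg j))⟩

end UMod

/-! ### Finite homological dimension, and indecomposables in the opposite category -/

namespace CategoryTheory

variable {C : Type*} [Category* C] [Abelian C]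

theorem projectiveDimension_ne_top_iff_exists_lt (X : C) :
    projectiveDimension X ≠ ⊤ ↔ ∃ m, HasProjectiveDimensionLT X m := by
  rw [projectiveDimension_ne_top_iff]
  exact ⟨fun ⟨m, h⟩ => ⟨m + 1, h⟩, fun ⟨m, h⟩ =>
    ⟨m, hasProjectiveDimensionLT_of_ge X m (m + 1) (by omega)⟩⟩

theorem injectiveDimension_ne_top_iff_exists_lt (X : C) :
    injectiveDimension X ≠ ⊤ ↔ ∃ m, HasInjectiveDimensionLT X m := by
  rw [injectiveDimension_ne_top_iff]
  exact ⟨fun ⟨m, h⟩ => ⟨m + 1, h⟩, fun ⟨m, h⟩ =>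
    ⟨m, hasInjectiveDimensionLT_of_ge X m (m + 1) (by omega)⟩⟩

/-- An object is indecomposable if its opposite is. -/
theorem Indecomposable.unop {X : Cᵒᵖ} (h : Indecomposable X) : Indecomposable X.unop := by
  refine ⟨fun h0 => h.1 h0.op, fun Y Z e => ?_⟩
  exact (h.2 (Opposite.op Y) (Opposite.op Z) (e.symm.op ≪≫ biprod.opIso Y Z)).imp
    (fun h => h.unop) fun h => h.unop

/-- The opposite of an indecomposable object is indecomposable. -/
theorem Indecomposable.op {X : C} (h : Indecomposable X) : Indecomposable (Opposite.op X) := by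
  refine ⟨fun h0 => h.1 h0.unop, fun Y Z e => ?_⟩
  let e' : Opposite.op X ≅ Opposite.op (Y.unop ⊞ Z.unop) :=
    e ≪≫ (biprod.opIso Y.unop Z.unop).symm
  exact (h.2 Y.unop Z.unop e'.unop.symm).imp
    (fun h => h.op) fun h => h.op

end CategoryTheory

end

/-! ### The classification and finiteness theorem -/

theorem mainTheorem9 (n : ℕ) (hn : 1 ≤ n) :
    -- the `I_λ` are a complete irredundant set of indecomposable injectives
    ((∀ lam : Fin n → YoungDiagram,
        Injective (UMod.injectiveOf lam) ∧ Indecomposable (UMod.injectiveOf lam)) ∧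
      (∀ M : UMod n, Injective M → Indecomposable M →
        ∃ lam : Fin n → YoungDiagram, Nonempty (M ≅ UMod.injectiveOf lam)) ∧
      (∀ lam mu : Fin n → YoungDiagram,
        Nonempty (UMod.injectiveOf lam ≅ UMod.injectiveOf mu) → lam = mu)) ∧
    -- the `P_λ` are a complete irredundant set of indecomposable projectives
    ((∀ lam : Fin n → YoungDiagram,
        Projective (UMod.projectiveOf lam) ∧ Indecomposable (UMod.projectiveOf lam)) ∧
      (∀ M : UMod n, Projective M → Indecomposable M →
        ∃ lam : Fin n → YoungDiagram, Nonempty (M ≅ UMod.projectiveOf lam)) ∧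
      (∀ lam mu : Fin n → YoungDiagram,
        Nonempty (UMod.projectiveOf lam ≅ UMod.projectiveOf mu) → lam = mu)) ∧
    -- every `𝒰`-module has finite injective and projective dimension
    (∀ M : UMod n, injectiveDimension M ≠ ⊤ ∧ projectiveDimension M ≠ ⊤) := by
  have hI := UMod.isTriangularFamily_injectiveOf (n := n)
  have hP := UMod.isTriangularFamily_projectiveOf (n := n)
  refine ⟨⟨fun lam => ⟨UMod.injective_injectiveOf lam, Indecomposable.unop (hI.indecomposable lam)⟩,
    fun M hM hM' => ?_, fun lam mu ⟨e⟩ => hI.eq_of_iso e.symm.op⟩,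
    ⟨fun lam => ⟨UMod.projective_projectiveOf lam, hP.indecomposable lam⟩,
    fun M hM hM' => hP.exists_iso_of_projective M hM', fun lam mu ⟨e⟩ => hP.eq_of_iso e⟩,
    fun M => ⟨?_, ?_⟩⟩
  · have : Projective (Opposite.op M) := Injective.injective_iff_projective_op.1 hM
    obtain ⟨lam, ⟨e⟩⟩ := hI.exists_iso_of_projective (Opposite.op M) (Indecomposable.op hM')
    exact ⟨lam, ⟨e.unop.symm⟩⟩
  · rw [injectiveDimension_ne_top_iff_exists_lt]
    refine hI.induction_shortExact (P := fun A => ∃ m, HasInjectiveDimensionLT A.unop m)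
      ?_ ?_ ?_ ?_ (Opposite.op M)
    · rintro A B e ⟨m, hm⟩
      exact
    ⟨m, hasInjectiveDimensionLT_of_iso e.unop.symm m⟩
    · intro A hA
      have : Injective A.unop := Injective.injective_iff_projective_op.2 hA
      exact ⟨1, inferInstance⟩
    -- Taking `unop` exchanges the outer terms, so the closure needed for `X₃` is the statement
    -- about `X₁` for injective dimension. The sum `m + m'` serves as a common bound, and the extra
    -- 1 is the dimension shift.
    · rintro S hS ⟨m, hm⟩ ⟨m', hm'⟩
      have h₃ : HasInjectiveDimensionLT S.unop.X₃ m := hm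
      have h₂ : HasInjectiveDimensionLT S.unop.X₂ m' := hm'
      exact ⟨m + m' + 1, hS.unop.hasInjectiveDimensionLT_X₁ (m + m')
        (hasInjectiveDimensionLT_of_ge _ m _ (by omega))
        (hasInjectiveDimensionLT_of_ge _ m' _ (by omega))⟩
    · rintro S hS ⟨m, hm⟩ ⟨m', hm'⟩
      have h₃ : HasInjectiveDimensionLT S.unop.X₃ m := hm
      have h₁ : HasInjectiveDimensionLT S.unop.X₁ m' := hm'
      exact ⟨m + m', hS.unop.hasInjectiveDimensionLT_X₂ (m + m')
        (hasInjectiveDimensionLT_of_ge _ m' _ (by omega))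
        (hasInjectiveDimensionLT_of_ge _ m _ (by omega))⟩
  · rw [projectiveDimension_ne_top_iff_exists_lt]
    refine hP.induction_shortExact (P := fun A => ∃ m, HasProjectiveDimensionLT A m)
      ?_ ?_ ?_ ?_ M
    · rintro A B e ⟨m, hm⟩
      exact
    ⟨m, hasProjectiveDimensionLT_of_iso e m⟩
    · intro A hA
      exact ⟨1, inferInstance⟩
    · rintro S hS ⟨m, hm⟩ ⟨m', hm'⟩
      exact ⟨m + m' + 1, hS.hasProjectiveDimensionLT_X₃ (m + m')
        (hasProjectiveDimensionLT_of_ge _ m _ (by omega))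
        (hasProjectiveDimensionLT_of_ge _ m' _ (by omega))⟩
    · rintro S hS ⟨m, hm⟩ ⟨m', hm'⟩
      exact ⟨m + m', hS.hasProjectiveDimensionLT_X₂ (m + m')
        (hasProjectiveDimensionLT_of_ge _ m _ (by omega))
        (hasProjectiveDimensionLT_of_ge _ m' _ (by omega))⟩
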